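/- Let $d\ge 1$ and let $\mu:[0,\infty)\times S^{d-1}\to\mathbb R^d$ be continuous, and continuously differentiable on $(0,\infty)\times S^{d-1}$. Assume that at $t=0$ the map is a single point different from the origin: there is $p\in\mathbb R^d$, $p\neq 0$, with $\mu(0,\xi)=p$ for all $\xi\in S^{d-1}$. Assume that $\mu$ has only finitely many zeros $(t_i,\xi_i)\in[0,\infty)\times S^{d-1}$, and that at each of them the Jacobian $$\det\frac{\partial\mu}{\partial(t,\xi)}=\det\big(\partial_t\mu,\ \partial_{e_1}\mu,\dots,\partial_{e_{d-1}}\mu\big)$$ is nonzero, where $(e_1,\dots,e_{d-1})$ is an orthonormal basis of the tangent space of $S^{d-1}$ at $\xi$ such that $(\xi,e_1,\dots,e_{d-1})$ is a positively oriented orthonormal basis of $\mathbb R^d$ (for $d=1$ and $\xi=\pm1$, the Jacobian is $\pm\partial_t\mu$). For a continuously differentiable $f:S^{d-1}\to\mathbb R^d\setminus\{0\}$ put $\hat f=f/\|f\|$ and define the winding number (degree) of $\hat f:S^{d-1}\to S^{d-1}$ by $$w_{d-1}[f]=\frac1{A_{d-1}}\int_{S^{d-1}}\sum_{i_1,\dots,i_d}\epsilon_{i_1\dots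 i_d}\,\hat f_{i_1}\,\partial_{e_1}\hat f_{i_2}\cdots\partial_{e_{d-1}}\hat f_{i_d}\,d\xi,$$ where $d\xi$ is the surface measure, $A_{d-1}=\int_{S^{d-1}}d\xi$, and the $e_j$ are as above (for $d=1$ this is $\tfrac12(\hat f(1)-\hat f(-1))$). Then for all sufficiently large $t$ the map $\mu(t,\cdot)$ has no zeros and the integrand defining $w_{d-1}[\mu(t,\cdot)]$ is integrable, and $$\lim_{t\to+\infty}w_{d-1}[\mu(t,\cdot)]=\sum_i \operatorname{sgn}\det\frac{\partial\mu}{\partial(t,\xi)}\bigg|_{(t_i,\xi_i)}.$$ -/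

import Mathlib

open Set Filter Topology MeasureTheory Metric
open scoped Manifold ContDiff

noncomputable section

/-- The Euclidean space `ℝ^d`. -/
abbrev Euc (d : ℕ) : Type := EuclideanSpace ℝ (Fin d)

/-- The unit sphere `S^{d-1}` of `ℝ^d`. -/
abbrev USphere (d : ℕ) : Type := sphere (0 : Euc d) 1

/-- The extension of a function on the unit sphere to `ℝ^d ∖ {0}` that is constant on rays,
`x ↦ f (x / ‖x‖)` (and `0` at the origin). -/
def radialExt {d : ℕ} (f : USphere d → Euc d) (x : Euc d) : Euc d :=
  if h : x ≠ 0 then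
    f ⟨‖x‖⁻¹ • x, by
      rw [mem_sphere_zero_iff_norm, norm_smul, norm_inv, norm_norm,
        inv_mul_cancel₀ (norm_ne_zero_iff.mpr h)]⟩
  else 0

/-- The differential of `f` along the sphere at `ξ`, as a linear map on all of `ℝ^d`: on tangent
vectors `v ⊥ ξ` it is the differential of `f`, and it vanishes on the normal vector `ξ`. -/
def sphereDeriv {d : ℕ} (f : USphere d → Euc d) (ξ : USphere d) : Euc d →L[ℝ] Euc d :=
  fderiv ℝ (radialExt f) (ξ : Euc d)

/-- For a vector `a` and the differential `D` of a map along the sphere at `ξ`, the determinant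
of the linear map sending the outward normal `ξ` to `a` and each tangent vector `v ⊥ ξ` to `D v`.
In a positively oriented orthonormal basis `(ξ, e₁, …, e_{d-1})` of `ℝ^d` it is the determinant
with columns `a, D e₁, …, D e_{d-1}`; see `normalDet_eq_sum`. -/
def normalDet {d : ℕ} (ξ : USphere d) (a : Euc d) (D : Euc d →L[ℝ] Euc d) : ℝ :=
  ((innerSL ℝ (ξ : Euc d)).smulRight a + D).det

/-- The density `ε_{i₁…i_d} f_{i₁} ∂_{ξ₁} f_{i₂} ⋯ ∂_{ξ_{d-1}} f_{i_d}` of the winding number, with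
respect to the surface measure of the sphere. -/
def windingDensity {d : ℕ} (f : USphere d → Euc d) (ξ : USphere d) : ℝ :=
  normalDet ξ (f ξ) (sphereDeriv f ξ)

/-- The surface measure of the unit sphere. -/
def surfaceMeasure (d : ℕ) : Measure (USphere d) := (volume : Measure (Euc d)).toSphere

/-- The normalized map `ξ ↦ μ(ξ) / ‖μ(ξ)‖`. -/
def unitMap {d : ℕ} (μ : USphere d → Euc d) (ξ : USphere d) : Euc d := ‖μ ξ‖⁻¹ • μ ξ

/-- The winding number of `μ / ‖μ‖ : S^{d-1} → S^{d-1}`, by the integral formula. -/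
def windingNumber {d : ℕ} (μ : USphere d → Euc d) : ℝ :=
  ((surfaceMeasure d).real univ)⁻¹ * ∫ ξ, windingDensity (unitMap μ) ξ ∂(surfaceMeasure d)

/-- The Jacobian determinant `det ∂μ/∂(t, ξ)` at `(t, ξ)`: the columns are the derivatives of `μ`
along `t` and along a frame `e₁, …, e_{d-1}` of the sphere with `(ξ, e₁, …, e_{d-1})` a positively
oriented orthonormal basis of `ℝ^d`. -/
def jacobianDet {d : ℕ} (μ : ℝ → USphere d → Euc d) (t : ℝ) (ξ : USphere d) : ℝ :=
  normalDet ξ (deriv (fun s => μ s ξ) t) (sphereDeriv (μ t) ξ)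

/-- The set of zeros of `μ` in `[0, ∞) × S^{d-1}`. -/
def zeroSet {d : ℕ} (μ : ℝ → USphere d → Euc d) : Set (ℝ × USphere d) :=
  {q | 0 ≤ q.1 ∧ μ q.1 q.2 = 0}

/-- The radial extension does not vary in the normal direction. -/
theorem sphereDeriv_normal {d : ℕ} (f : USphere d → Euc d) (ξ : USphere d) :
    sphereDeriv f ξ (ξ : Euc d) = 0 := by
  have hξ : ‖(ξ : Euc d)‖ = 1 := by simp
  have hξ0 : (ξ : Euc d) ≠ 0 := by
    intro h
    simp [h] at hξ
  unfold sphereDeriv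
  by_cases hd : DifferentiableAt ℝ (radialExt f) (ξ : Euc d)
  · have h1 : HasDerivAt (fun r : ℝ => r • (ξ : Euc d)) ((1 : ℝ) • (ξ : Euc d)) 1 :=
      (hasDerivAt_id (1 : ℝ)).smul_const (ξ : Euc d)
    have hd' : HasFDerivAt (radialExt f) (fderiv ℝ (radialExt f) (ξ : Euc d))
        ((fun r : ℝ => r • (ξ : Euc d)) 1) := by
      simpa using hd.hasFDerivAt
    have h2 := hd'.comp_hasDerivAt (1 : ℝ) h1
    have h3 : (radialExt f ∘ fun r : ℝ => r • (ξ : Euc d)) =ᶠ[𝓝 1] fun _ => f ξ := by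
      filter_upwards [lt_mem_nhds (zero_lt_one' ℝ)] with r hr
      have hr0 : r • (ξ : Euc d) ≠ 0 := smul_ne_zero hr.ne' hξ0
      simp only [Function.comp, radialExt, dif_pos hr0]
      congr 1
      apply Subtype.ext
      simp [norm_smul, hξ, abs_of_pos hr, smul_smul, inv_mul_cancel₀ hr.ne']
    have h4 := (h2.congr_of_eventuallyEq h3.symm).unique (hasDerivAt_const (1 : ℝ) (f ξ))
    simpa using h4
  · simp [fderiv_zero_of_not_differentiableAt hd]

/-- `normalDet` by the Levi-Civita symbol, in any orthonormal basis that starts with the outward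
normal; the first factor is `1` or `-1`, according to the orientation of the basis. -/
theorem normalDet_eq_sum {m : ℕ} (ξ : USphere (m + 1)) (a : Euc (m + 1))
    (D : Euc (m + 1) →L[ℝ] Euc (m + 1)) (hD : D (ξ : Euc (m + 1)) = 0)
    (b : OrthonormalBasis (Fin (m + 1)) ℝ (Euc (m + 1))) (hb : b 0 = (ξ : Euc (m + 1))) :
    normalDet ξ a D = (EuclideanSpace.basisFun (Fin (m + 1)) ℝ).toBasis.det b *
      ∑ σ : Equiv.Perm (Fin (m + 1)), ((Equiv.Perm.sign σ : ℤ) : ℝ) *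
        (a (σ 0) * ∏ k : Fin m, D (b k.succ) (σ k.succ)) := by
  set e := (EuclideanSpace.basisFun (Fin (m + 1)) ℝ).toBasis with he
  set L : Euc (m + 1) →L[ℝ] Euc (m + 1) := (innerSL ℝ (ξ : Euc (m + 1))).smulRight a + D with hL
  have h1 : e.det ((L : Euc (m + 1) →ₗ[ℝ] Euc (m + 1)) ∘ b) = L.det * e.det b :=
    Module.Basis.det_comp e _ _
  have h2 : e.det b * e.det b = 1 := by
    rcases OrthonormalBasis.det_to_matrix_orthonormalBasis_real
      (EuclideanSpace.basisFun (Fin (m + 1)) ℝ) b with h | h <;> rw [he, h] <;> norm_num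
  have hξ : ‖(ξ : Euc (m + 1))‖ = 1 := by simp
  have hL0 : L (b 0) = a := by
    simp [hL, hb, hD, hξ]
  have hLs : ∀ k : Fin m, L (b k.succ) = D (b k.succ) := by
    intro k
    have h0 : inner ℝ (ξ : Euc (m + 1)) (b k.succ) = 0 := by
      rw [← hb]
      exact b.orthonormal.2 (Fin.succ_ne_zero k).symm
    simp [hL, h0]
  have h3 : e.det ((L : Euc (m + 1) →ₗ[ℝ] Euc (m + 1)) ∘ b) =
      ∑ σ : Equiv.Perm (Fin (m + 1)), ((Equiv.Perm.sign σ : ℤ) : ℝ) *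
        (a (σ 0) * ∏ k : Fin m, D (b k.succ) (σ k.succ)) := by
    rw [Module.Basis.det_apply, Matrix.det_apply']
    refine Finset.sum_congr rfl fun σ _ => ?_
    rw [Fin.prod_univ_succ]
    simp [he, Module.Basis.toMatrix_apply, hL0, hLs]
  rw [← h3, h1]
  change L.det = _
  linear_combination (-L.det) * h2

end

noncomputable section

/-! Read `t` and `ξ` as polar coordinates, so that `μ` becomes a map `F (t ξ) = μ (t, ξ)` on `ℝ^d`.
Because `μ` starts at a single point `p ≠ 0`, `F` can be altered near the origin into a `C¹` map
without creating zeros (`exists_contDiff_extension`). Zeros of `μ` correspond to zeros of `F`, and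
the two Jacobians differ by the factor `t ^ (d - 1) > 0` (`jacobianDet_eq`). What remains is the
classical statement that the degree of `F / ‖F‖` on a sphere enclosing all zeros is their signed
count.

The winding density is the pullback by `F` of the flux of `y / ‖y‖ ^ d`, a field free of divergence
off the origin. Let `V` be a `C¹` field that agrees with it outside a small ball (`exists_kernel`).
As `F` is only `C¹`, Stokes' theorem is used in a weak form, `integral_null_lagrangian`, against a
radial cutoff `χ` that is constant on a ball containing the zeros. The term with the gradient of `χ`
is an average of winding integrals over radii. The other term contains `(div V) ∘ F * det DF`; it is
concentrated near the zeros, and a change of variables turns it into the sum of signs times `∫ div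
V` (`exists_integral_eq_sum_sign`). Taking `F = id` with the same `V` shows that this last factor is
the area of the sphere. Since the averaged identity holds for all test functions of the radius and
the winding integral is continuous in the radius, it holds at every radius beyond the zeros
(`integral_sphereDensity_eq`).

The weak Stokes formula reduces to `∫ det Du = 0` for compactly supported `C¹` maps `u`
(`integral_det_fderiv_eq_zero`): for small `t` the map `x + t u(x)` permutes a ball, so the integral
of its Jacobian, a polynomial in `t`, is constant. -/

/-! ### Jacobian determinants of compactly supported maps. -/

/-- The matrix of a linear map in the standard basis. -/
def stdMatrix {d : ℕ} (L : Euc d →L[ℝ] Euc d) : Matrix (Fin d) (Fin d) ℝ :=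
  Matrix.of fun i j => L (EuclideanSpace.single j 1) i

theorem det_stdMatrix {d : ℕ} (L : Euc d →L[ℝ] Euc d) : (stdMatrix L).det = L.det := by
  have h : stdMatrix L = LinearMap.toMatrix (EuclideanSpace.basisFun (Fin d) ℝ).toBasis
      (EuclideanSpace.basisFun (Fin d) ℝ).toBasis (L : Euc d →ₗ[ℝ] Euc d) := by
    ext i j
    simp [stdMatrix, LinearMap.toMatrix_apply]
  rw [h, LinearMap.det_toMatrix]

theorem continuous_stdMatrix {d : ℕ} :
    Continuous (stdMatrix : (Euc d →L[ℝ] Euc d) → Matrix (Fin d) (Fin d) ℝ) := by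
  refine continuous_matrix fun i j => ?_
  simp only [stdMatrix, Matrix.of_apply]
  fun_prop

theorem stdMatrix_one_add_smul {d : ℕ} (t : ℝ) (L : Euc d →L[ℝ] Euc d) :
    stdMatrix (1 + t • L) = t • stdMatrix L + 1 := by
  ext i j
  simp [stdMatrix, Matrix.one_apply, add_comm]

/-- The matrix with the rows of `M` at the indices in `s` and those of the identity elsewhere. -/
def rowsOrOne {d : ℕ} (s : Finset (Fin d)) (M : Matrix (Fin d) (Fin d) ℝ) :
    Matrix (Fin d) (Fin d) ℝ :=
  Matrix.of fun i j => if i ∈ s then M i j else (1 : Matrix (Fin d) (Fin d) ℝ) i j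

/-- The expansion of `det (t • M + 1)` in powers of `t`. -/
theorem det_smul_add_one_eq_sum {d : ℕ} (t : ℝ) (M : Matrix (Fin d) (Fin d) ℝ) :
    (t • M + 1).det = ∑ s : Finset (Fin d), t ^ s.card * (rowsOrOne s M).det := by
  have h := (Matrix.detRowAlternating (n := Fin d) (R := ℝ)).toMultilinearMap.map_add_univ
    (fun i j => t * M i j) (fun i j => (1 : Matrix (Fin d) (Fin d) ℝ) i j)
  refine Eq.trans ?_ (h.trans (Finset.sum_congr rfl fun s _ => ?_))
  · rfl
  · have := (Matrix.detRowAlternating (n := Fin d) (R := ℝ)).toMultilinearMap.map_piecewise_smul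
      (fun _ => t) (fun i j => rowsOrOne s M i j) s
    simp only [Finset.prod_const, smul_eq_mul] at this
    refine Eq.trans ?_ this
    congr 1
    funext i j
    by_cases hi : i ∈ s <;> simp [hi, rowsOrOne]

/-- A perturbation of the identity by a compactly supported map preserves the volume of a ball that
contains the support. -/
theorem eventually_integral_det_one_add_smul_fderiv {d : ℕ} {u : Euc d → Euc d}
    (hu : ContDiff ℝ 1 u) (hc : HasCompactSupport u) {R : ℝ} (hR : tsupport u ⊆ ball 0 R) :
    ∀ᶠ t : ℝ in 𝓝 0, ∫ x in ball (0 : Euc d) R, (1 + t • fderiv ℝ u x).det =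
      volume.real (ball (0 : Euc d) R) := by
  obtain ⟨C, hC⟩ := hu.lipschitzWith_of_hasCompactSupport hc one_ne_zero
  have hpos : ∀ᶠ A : Euc d →L[ℝ] Euc d in 𝓝 0, 0 < (1 + A).det := by
    have hcont : Continuous fun A : Euc d →L[ℝ] Euc d => (1 + A).det :=
      ContinuousLinearMap.continuous_det.comp (continuous_const.add continuous_id)
    refine hcont.continuousAt.eventually (lt_mem_nhds ?_)
    simp [ContinuousLinearMap.det]
  obtain ⟨δ, hδ, hδpos⟩ := Metric.eventually_nhds_iff.1 hpos
  -- This bound makes `x + t u(x)` a bijection, being a Lipschitz perturbation of the identity with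
  -- constant below `1`. The next one keeps its Jacobian positive, so that the absolute value in the
  -- change of variables disappears.
  have h1 : ∀ᶠ t : ℝ in 𝓝 0, |t| * C < 1 := by
    have : Continuous fun t : ℝ => |t| * (C : ℝ) := by fun_prop
    exact this.continuousAt.eventually (gt_mem_nhds (by simp))
  have h2 : ∀ᶠ t : ℝ in 𝓝 0, |t| * C < δ := by
    have : Continuous fun t : ℝ => |t| * (C : ℝ) := by fun_prop
    exact this.continuousAt.eventually (gt_mem_nhds (by simpa using hδ))
  filter_upwards [h1, h2] with t ht1 ht2
  set φ : Euc d → Euc d := fun x => x + t • u x with hφ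
  have hfd : ∀ x, HasFDerivAt φ (1 + t • fderiv ℝ u x) x := fun x =>
    (hasFDerivAt_id x).add (((hu.differentiable one_ne_zero) x).hasFDerivAt.const_smul t)
  have hdet : ∀ x, 0 < (1 + t • fderiv ℝ u x).det := by
    intro x
    apply hδpos
    rw [dist_zero_right, norm_smul, Real.norm_eq_abs]
    exact (mul_le_mul_of_nonneg_left (norm_fderiv_le_of_lipschitz ℝ hC) (abs_nonneg t)).trans_lt ht2
  have happ : ApproximatesLinearOn φ
      ((ContinuousLinearEquiv.refl ℝ (Euc d) : Euc d ≃L[ℝ] Euc d) : Euc d →L[ℝ] Euc d) univ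
      (‖t‖₊ * C) := by
    intro x _ y _
    have : φ x - φ y - (x - y) = t • (u x - u y) := by simp only [hφ, smul_sub]; abel
    simp only [ContinuousLinearEquiv.coe_refl, ContinuousLinearMap.id_apply, this, norm_smul]
    have h3 := hC.dist_le_mul x y
    rw [dist_eq_norm, dist_eq_norm] at h3
    calc ‖t‖ * ‖u x - u y‖ ≤ |t| * (C * ‖x - y‖) := by
          rw [Real.norm_eq_abs]; exact mul_le_mul_of_nonneg_left h3 (abs_nonneg t)
      _ = _ := by simp [mul_assoc]
  have hlt : Subsingleton (Euc d) ∨ (‖t‖₊ * C : NNReal) <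
      ‖(((ContinuousLinearEquiv.refl ℝ (Euc d)).symm : Euc d ≃L[ℝ] Euc d) :
        Euc d →L[ℝ] Euc d)‖₊⁻¹ := by
    rcases subsingleton_or_nontrivial (Euc d) with hs | hs
    · exact Or.inl hs
    · right
      have : ‖(((ContinuousLinearEquiv.refl ℝ (Euc d)).symm : Euc d ≃L[ℝ] Euc d) :
        Euc d →L[ℝ] Euc d)‖₊ = 1 := by
        apply NNReal.eq
        simp
      rw [this, inv_one, ← NNReal.coe_lt_coe]
      simpa using ht1
  have hinj : Function.Injective φ := by
    have := happ.injective hlt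
    exact fun x y h => congrArg Subtype.val (@this ⟨x, mem_univ _⟩ ⟨y, mem_univ _⟩ h)
  have hsurj : Function.Surjective φ := happ.surjective hlt
  have hid : ∀ x, x ∉ ball (0 : Euc d) R → φ x = x := by
    intro x hx
    have : u x = 0 := image_eq_zero_of_notMem_tsupport fun h => hx (hR h)
    simp [hφ, this]
  -- A bijection that fixes every point outside the ball maps the ball onto itself.
  have himg : φ '' ball (0 : Euc d) R = ball 0 R := by
    apply Subset.antisymm
    · rintro _ ⟨x, hx, rfl⟩
      by_contra h
      exact h (by rwa [hinj (hid _ h)])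
    · intro y hy
      obtain ⟨x, rfl⟩ := hsurj y
      refine ⟨x, ?_, rfl⟩
      by_contra h
      rw [hid x h] at hy
      exact h hy
  have := integral_image_eq_integral_abs_det_fderiv_smul volume
    (measurableSet_ball (x := (0 : Euc d)) (ε := R))
    (fun x _ => (hfd x).hasFDerivWithinAt) hinj.injOn (fun _ => (1 : ℝ))
  rw [himg] at this
  simp only [smul_eq_mul, mul_one, abs_of_pos (hdet _)] at this
  rw [← this]
  simp

/-- The Jacobian determinant of a compactly supported `C¹` map has integral zero. -/
theorem integral_det_fderiv_eq_zero {d : ℕ} (hd : d ≠ 0) {u : Euc d → Euc d}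
    (hu : ContDiff ℝ 1 u) (hc : HasCompactSupport u) :
    ∫ x, (fderiv ℝ u x).det = 0 := by
  obtain ⟨R, hR⟩ := hc.isCompact.isBounded.subset_ball (0 : Euc d)
  have hvol := eventually_integral_det_one_add_smul_fderiv hu hc hR
  set c : Finset (Fin d) → ℝ := fun s => ∫ x in ball (0 : Euc d) R,
    (rowsOrOne s (stdMatrix (fderiv ℝ u x))).det with hcdef
  have hcont : ∀ s : Finset (Fin d), Continuous fun x : Euc d =>
      (rowsOrOne s (stdMatrix (fderiv ℝ u x))).det := by
    intro s
    have hM : Continuous fun x => stdMatrix (fderiv ℝ u x) :=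
      continuous_stdMatrix.comp (hu.continuous_fderiv one_ne_zero)
    refine Continuous.matrix_det (continuous_matrix fun i j => ?_)
    by_cases hi : i ∈ s
    · simpa [hi, rowsOrOne] using hM.matrix_elem i j
    · simpa [hi, rowsOrOne] using continuous_const
  have hexp : ∀ t : ℝ, ∫ x in ball (0 : Euc d) R, (1 + t • fderiv ℝ u x).det =
      ∑ s : Finset (Fin d), t ^ s.card * c s := by
    intro t
    simp_rw [← det_stdMatrix, stdMatrix_one_add_smul, det_smul_add_one_eq_sum]
    rw [integral_finsetSum]
    · simp_rw [integral_const_mul, hcdef]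
    · intro s _
      exact (((hcont s).const_mul _).continuousOn.integrableOn_compact
        (isCompact_closedBall (0 : Euc d) R)).mono_set ball_subset_closedBall
  -- The volume is a polynomial in `t` that is constant near `0`, hence a constant polynomial. Its
  -- coefficient of `t ^ d`, which comes from the full row set alone, is the integral sought; `d ≠
  -- 0` separates it from the constant term.
  set P : Polynomial ℝ := ∑ s : Finset (Fin d), Polynomial.C (c s) * Polynomial.X ^ s.card with hP
  have hPeq : P = Polynomial.C (volume.real (ball (0 : Euc d) R)) := by
    apply Polynomial.eq_of_infinite_eval_eq
    refine Set.Infinite.mono (s := {t : ℝ | ∫ x in ball (0 : Euc d) R,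
      (1 + t • fderiv ℝ u x).det = volume.real (ball (0 : Euc d) R)}) ?_
      (infinite_of_mem_nhds 0 hvol)
    intro t ht
    change _ = _ at ht
    change _ = _
    rw [hexp] at ht
    rw [Polynomial.eval_C, ← ht, hP, Polynomial.eval_finsetSum]
    refine Finset.sum_congr rfl fun s _ => ?_
    rw [Polynomial.eval_mul, Polynomial.eval_C, Polynomial.eval_pow, Polynomial.eval_X, mul_comm]
  have hcoef := congrArg (fun Q => Polynomial.coeff Q d) hPeq
  simp only [hP, Polynomial.finsetSum_coeff, Polynomial.coeff_C_mul_X_pow,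
    Polynomial.coeff_C, if_neg hd] at hcoef
  have hall : ∀ M : Matrix (Fin d) (Fin d) ℝ, rowsOrOne Finset.univ M = M := by
    intro M
    ext i j
    simp [rowsOrOne]
  rw [Finset.sum_eq_single Finset.univ] at hcoef
  · simp only [Finset.card_univ, Fintype.card_fin, if_true, hcdef, hall, det_stdMatrix] at hcoef
    rw [← hcoef, setIntegral_eq_integral_of_forall_compl_eq_zero]
    intro x hx
    have : fderiv ℝ u x = 0 := image_eq_zero_of_notMem_tsupport fun h =>
      hx (hR (tsupport_fderiv_subset ℝ h))
    have : Nonempty (Fin d) := ⟨⟨0, Nat.pos_of_ne_zero hd⟩⟩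
    rw [‹fderiv ℝ u x = 0›, ← det_stdMatrix]
    have h0 : stdMatrix (0 : Euc d →L[ℝ] Euc d) = 0 := by ext; simp [stdMatrix]
    rw [h0, Matrix.det_zero]
  · intro s _ hs
    rw [if_neg]
    intro h
    exact hs ((Finset.card_eq_iff_eq_univ s).1 (by simp [h]))
  · simp

/-! ### Rank-one updates and the weak Stokes formula. -/

theorem apply_eq_sum_stdMatrix {d : ℕ} (L : Euc d →L[ℝ] Euc d) (v : Euc d) (i : Fin d) :
    L v i = ∑ k, stdMatrix L i k * v k := by
  have hv : v = ∑ k, v k • EuclideanSpace.single k (1 : ℝ) := by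
    have := (EuclideanSpace.basisFun (Fin d) ℝ).sum_repr v
    simpa using this.symm
  conv_lhs => rw [hv]
  simp [stdMatrix, mul_comm]

/-- The matrix determinant lemma, in terms of row replacements. -/
theorem det_add_vecMulVec {d : ℕ} (M : Matrix (Fin d) (Fin d) ℝ) (v w : Fin d → ℝ) :
    (M + Matrix.vecMulVec v w).det = M.det + ∑ i, v i * (M.updateRow i w).det := by
  -- For invertible `A`, writing `v = A z` factors out `A` and leaves `det (1 + z wᵀ) = 1 + w · z`.
  have hunit : ∀ A : Matrix (Fin d) (Fin d) ℝ, A.det ≠ 0 →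
      (A + Matrix.vecMulVec v w).det = A.det + ∑ i, v i * (A.updateRow i w).det := by
    intro A hA
    obtain ⟨z, rfl⟩ : ∃ z, v = A.mulVec z := ⟨A⁻¹.mulVec v, by
      rw [Matrix.mulVec_mulVec, Matrix.mul_nonsing_inv _ (isUnit_iff_ne_zero.2 hA),
        Matrix.one_mulVec]⟩
    have h1 : A + Matrix.vecMulVec (A.mulVec z) w = A * (1 + Matrix.vecMulVec z w) := by
      rw [mul_add, mul_one, Matrix.mul_vecMulVec]
    have h2 : ∀ i, (A.updateRow i w).det = A.adjugate.transpose.mulVec w i := by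
      intro i
      rw [← Matrix.cramer_transpose_apply, Matrix.cramer_eq_adjugate_mulVec,
        Matrix.adjugate_transpose]
    have h3 : ∑ i, A.mulVec z i * (A.updateRow i w).det = A.det * (w ⬝ᵥ z) := by
      simp_rw [h2]
      change A.mulVec z ⬝ᵥ A.adjugate.transpose.mulVec w = _
      rw [Matrix.mulVec_transpose, dotProduct_comm, ← Matrix.dotProduct_mulVec,
        Matrix.mulVec_mulVec, Matrix.adjugate_mul, Matrix.smul_mulVec, Matrix.one_mulVec,
        dotProduct_smul, smul_eq_mul]
    rw [h1, h3, Matrix.det_mul, Matrix.vecMulVec_eq Unit,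
      Matrix.det_one_add_replicateCol_mul_replicateRow, mul_add, mul_one]
  -- A singular `M` is reached as a limit: `M + ε` is invertible for all small `ε ≠ 0`, since `-M`
  -- has finitely many eigenvalues, and both sides are continuous in `ε`.
  set A : ℝ → Matrix (Fin d) (Fin d) ℝ := fun ε => M + ε • (1 : Matrix (Fin d) (Fin d) ℝ) with hA
  have hAc : Continuous A := by fun_prop
  have hne : ∀ᶠ ε in 𝓝[≠] (0 : ℝ), (A ε).det ≠ 0 := by
    have hfin : {ε : ℝ | (-M).charpoly.IsRoot ε}.Finite :=
      Polynomial.finite_setOfPred_isRoot (-M).charpoly_monic.ne_zero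
    have : ∀ᶠ ε in 𝓝[≠] (0 : ℝ), ε ∉ {ε : ℝ | (-M).charpoly.IsRoot ε} := by
      have h : ({ε : ℝ | (-M).charpoly.IsRoot ε} \ {0})ᶜ ∈ 𝓝 (0 : ℝ) :=
        (hfin.subset sdiff_subset).isClosed.compl_mem_nhds fun h => h.2 rfl
      filter_upwards [mem_nhdsWithin_of_mem_nhds h, self_mem_nhdsWithin] with ε h1 h2 h3
      exact h1 ⟨h3, h2⟩
    filter_upwards [this] with ε hε h0
    apply hε
    change Polynomial.eval ε _ = 0
    rw [Matrix.eval_charpoly, ← h0]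
    congr 1
    simp [hA, Matrix.smul_one_eq_diagonal, add_comm]
  have hl : Tendsto (fun ε => (A ε + Matrix.vecMulVec v w).det) (𝓝[≠] 0)
      (𝓝 (M + Matrix.vecMulVec v w).det) := by
    have : Continuous fun ε => (A ε + Matrix.vecMulVec v w).det :=
      (hAc.add continuous_const).matrix_det
    simpa [hA] using (this.tendsto 0).mono_left nhdsWithin_le_nhds
  have hr : Tendsto (fun ε => (A ε).det + ∑ i, v i * ((A ε).updateRow i w).det) (𝓝[≠] 0)
      (𝓝 (M.det + ∑ i, v i * (M.updateRow i w).det)) := by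
    have : Continuous fun ε => (A ε).det + ∑ i, v i * ((A ε).updateRow i w).det :=
      hAc.matrix_det.add (continuous_finsetSum _ fun i _ =>
        continuous_const.mul (hAc.matrix_updateRow i continuous_const).matrix_det)
    simpa [hA] using (this.tendsto 0).mono_left nhdsWithin_le_nhds
  refine tendsto_nhds_unique hl (hr.congr' ?_)
  filter_upwards [hne] with ε hε
  exact (hunit _ hε).symm

/-- The divergence of a vector field. -/
def divergence {d : ℕ} (V : Euc d → Euc d) (y : Euc d) : ℝ :=
  ∑ i, fderiv ℝ V y (EuclideanSpace.single i 1) i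

/-- The gradient of a function, as a row of partial derivatives. -/
def partials {d : ℕ} (χ : Euc d → ℝ) (x : Euc d) : Fin d → ℝ :=
  fun j => fderiv ℝ χ x (EuclideanSpace.single j 1)

theorem fderiv_apply_coord {d : ℕ} {u : Euc d → Euc d} {x : Euc d} (hu : DifferentiableAt ℝ u x)
    (v : Euc d) (k : Fin d) : fderiv ℝ u x v k = fderiv ℝ (fun y => u y k) x v := by
  have := ((EuclideanSpace.proj (𝕜 := ℝ) k).hasFDerivAt (x := u x)).comp x hu.hasFDerivAt
  have h2 : fderiv ℝ (fun y => u y k) x = _ := this.fderiv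
  rw [h2]
  simp

theorem contDiff_euc {d : ℕ} {u : Euc d → Euc d} (h : ∀ k, ContDiff ℝ 1 fun x => u x k) :
    ContDiff ℝ 1 u := contDiff_euclidean.2 h

theorem ContDiff.coord {d : ℕ} {u : Euc d → Euc d} (h : ContDiff ℝ 1 u) (k : Fin d) :
    ContDiff ℝ 1 fun x => u x k := contDiff_euclidean.1 h k

/-- One summand of `integral_null_lagrangian`. -/
theorem integrable_and_integral_row {d : ℕ} (hd : d ≠ 0) {F V : Euc d → Euc d} {χ : Euc d → ℝ}
    (hF : ContDiff ℝ 1 F) (hV : ContDiff ℝ 1 V) (hχ : ContDiff ℝ 1 χ) (hc : HasCompactSupport χ)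
    (i : Fin d) :
    Integrable (fun x => V (F x) i * ((stdMatrix (fderiv ℝ F x)).updateRow i (partials χ x)).det +
      χ x * (fderiv ℝ V (F x) (EuclideanSpace.single i 1) i * (fderiv ℝ F x).det)) ∧
    ∫ x, (V (F x) i * ((stdMatrix (fderiv ℝ F x)).updateRow i (partials χ x)).det +
      χ x * (fderiv ℝ V (F x) (EuclideanSpace.single i 1) i * (fderiv ℝ F x).det)) = 0 := by
  obtain ⟨R, hRpos, hR⟩ := hc.isCompact.isBounded.subset_ball_lt 0 (0 : Euc d)
  -- The map `u` is `F` with coordinate `i` replaced by `χ * (V ∘ F)_i` and the others multiplied by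
  -- `η`. Since `η = 1` near the support of `χ`, the factor `η` gives compact support without
  -- affecting the Jacobian: off that support row `i` vanishes anyway.
  set η : ContDiffBump (0 : Euc d) := ⟨R, R + 1, hRpos, by linarith⟩ with hη
  set u : Euc d → Euc d := fun x =>
    WithLp.toLp 2 fun k => if k = i then χ x * V (F x) i else η x * F x k with hu
  have hη1 : ContDiff ℝ 1 η := η.contDiff
  have huk : ∀ k, (fun x => u x k) =
      if k = i then fun x => χ x * V (F x) i else fun x => η x * F x k := by
    intro k
    by_cases hk : k = i <;> simp [hu, hk]
  have huC : ContDiff ℝ 1 u := by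
    refine contDiff_euc fun k => ?_
    rw [huk]
    by_cases hk : k = i
    · rw [if_pos hk]
      exact hχ.mul ((hV.comp hF).coord i)
    · rw [if_neg hk]
      exact hη1.mul (hF.coord k)
  have huc : HasCompactSupport u := by
    refine HasCompactSupport.intro (isCompact_closedBall (0 : Euc d) (R + 1)) fun x hx => ?_
    have h1 : χ x = 0 := image_eq_zero_of_notMem_tsupport fun h => hx
      (closedBall_subset_closedBall (by linarith) (ball_subset_closedBall (hR h)))
    have h2 : η x = 0 := η.zero_of_le_dist (by
      simp only [mem_closedBall, not_le] at hx
      exact hx.le)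
    ext k
    simp [hu, h1, h2]
  have hpt : (fun x => (fderiv ℝ u x).det) = fun x =>
      V (F x) i * ((stdMatrix (fderiv ℝ F x)).updateRow i (partials χ x)).det +
      χ x * (fderiv ℝ V (F x) (EuclideanSpace.single i 1) i * (fderiv ℝ F x).det) := by
    funext x
    have hud := huC.differentiable one_ne_zero x
    have hFd := hF.differentiable one_ne_zero x
    have hVd := hV.differentiable one_ne_zero (F x)
    have hχd := hχ.differentiable one_ne_zero x
    rw [← det_stdMatrix, ← det_stdMatrix]
    have hrow : ∀ j, stdMatrix (fderiv ℝ u x) i j = V (F x) i * partials χ x j +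
        χ x * ∑ k, stdMatrix (fderiv ℝ V (F x)) i k * stdMatrix (fderiv ℝ F x) k j := by
      intro j
      simp only [stdMatrix, Matrix.of_apply, partials]
      rw [fderiv_apply_coord hud, huk, if_pos rfl]
      have hVF : DifferentiableAt ℝ (fun y => V (F y)) x := hVd.comp x hFd
      have hVFi : DifferentiableAt ℝ (fun y => V (F y) i) x :=
        ((hV.comp hF).coord i).differentiable one_ne_zero x
      have h1 : fderiv ℝ (fun y => V (F y) i) x (EuclideanSpace.single j 1) =
          fderiv ℝ V (F x) (fderiv ℝ F x (EuclideanSpace.single j 1)) i := by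
        rw [← fderiv_apply_coord hVF, fderiv_fun_comp x hVd hFd]
        rfl
      rw [fderiv_fun_mul hχd hVFi]
      have h2 := apply_eq_sum_stdMatrix (fderiv ℝ V (F x))
        (fderiv ℝ F x (EuclideanSpace.single j 1)) i
      simp only [stdMatrix, Matrix.of_apply] at h2
      rw [← h2, ← h1]
      simp
      ring
    by_cases hx : x ∈ tsupport χ
    · have hM : stdMatrix (fderiv ℝ u x) = (stdMatrix (fderiv ℝ F x)).updateRow i
          (V (F x) i • partials χ x + χ x •
            ∑ k, stdMatrix (fderiv ℝ V (F x)) i k • stdMatrix (fderiv ℝ F x) k) := by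
        ext k j
        by_cases hk : k = i
        · subst hk
          rw [hrow, Matrix.updateRow_self]
          simp
        · rw [Matrix.updateRow_ne hk]
          simp only [stdMatrix, Matrix.of_apply]
          rw [fderiv_apply_coord hud, fderiv_apply_coord hFd, huk, if_neg hk]
          have : (fun y => η y * F y k) =ᶠ[𝓝 x] fun y => F y k := by
            filter_upwards [isOpen_ball.mem_nhds (hR hx)] with y hy
            rw [η.one_of_mem_closedBall (ball_subset_closedBall hy), one_mul]
          rw [this.fderiv_eq]
      -- By the chain rule the `χ`-part of row `i` is a combination of the rows of `DF`. Only row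
      -- `i` itself contributes, the other terms having a repeated row.
      rw [hM, Matrix.det_updateRow_add, Matrix.det_updateRow_smul, Matrix.det_updateRow_smul,
        Matrix.det_updateRow_sum]
      simp [stdMatrix]
    · have h0 : χ x = 0 := image_eq_zero_of_notMem_tsupport hx
      have h1 : partials χ x = 0 := by
        funext j
        have : fderiv ℝ χ x = 0 := image_eq_zero_of_notMem_tsupport fun h =>
          hx (tsupport_fderiv_subset ℝ h)
        simp [partials, this]
      rw [h0, h1, Matrix.det_eq_zero_of_row_eq_zero i fun j => by rw [hrow, h0, h1]; simp,
        Matrix.det_eq_zero_of_row_eq_zero (A := Matrix.updateRow _ i _) i fun j => by simp]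
      simp
  rw [← hpt]
  refine ⟨?_, integral_det_fderiv_eq_zero hd huC huc⟩
  refine Continuous.integrable_of_hasCompactSupport
    (ContinuousLinearMap.continuous_det.comp (huC.continuous_fderiv one_ne_zero)) ?_
  refine (huc.fderiv ℝ).comp_left (g := ContinuousLinearMap.det) ?_
  have : Nonempty (Fin d) := ⟨i⟩
  have h0 : stdMatrix (0 : Euc d →L[ℝ] Euc d) = 0 := by ext; simp [stdMatrix]
  rw [← det_stdMatrix, h0, Matrix.det_zero]

/-- For `C¹` maps, the pullback of a divergence form integrates against a compactly supported
function by parts. -/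
theorem integral_null_lagrangian {d : ℕ} (hd : d ≠ 0) {F V : Euc d → Euc d} {χ : Euc d → ℝ}
    (hF : ContDiff ℝ 1 F) (hV : ContDiff ℝ 1 V) (hχ : ContDiff ℝ 1 χ)
    (hc : HasCompactSupport χ) :
    ∫ x, ((∑ i, V (F x) i * ((stdMatrix (fderiv ℝ F x)).updateRow i (partials χ x)).det) +
      χ x * (divergence V (F x) * (fderiv ℝ F x).det)) = 0 := by
  have h : ∀ x, ((∑ i, V (F x) i * ((stdMatrix (fderiv ℝ F x)).updateRow i (partials χ x)).det) +
      χ x * (divergence V (F x) * (fderiv ℝ F x).det)) = ∑ i,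
      (V (F x) i * ((stdMatrix (fderiv ℝ F x)).updateRow i (partials χ x)).det +
      χ x * (fderiv ℝ V (F x) (EuclideanSpace.single i 1) i * (fderiv ℝ F x).det)) := by
    intro x
    rw [Finset.sum_add_distrib, divergence, Finset.sum_mul, Finset.mul_sum]
  simp_rw [h]
  rw [integral_finsetSum _ fun i _ => (integrable_and_integral_row hd hF hV hχ hc i).1]
  exact Finset.sum_eq_zero fun i _ => (integrable_and_integral_row hd hF hV hχ hc i).2

/-! ### Counting nondegenerate zeros by an integral. -/

/-- A `C¹` map is injective, with a Jacobian determinant of constant sign, near a nondegenerate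
zero. -/
theorem exists_injOn_nhds {d : ℕ} {F : Euc d → Euc d} (hF : ContDiff ℝ 1 F) {z : Euc d}
    (hz : (fderiv ℝ F z).det ≠ 0) {W : Set (Euc d)} (hW : W ∈ 𝓝 z) :
    ∃ U ⊆ W, IsOpen U ∧ z ∈ U ∧ InjOn F U ∧ F '' U ∈ 𝓝 (F z) ∧
      ∀ x ∈ U, (fderiv ℝ F x).det = Real.sign (fderiv ℝ F z).det * |(fderiv ℝ F x).det| := by
  set f' : Euc d ≃L[ℝ] Euc d :=
    ContinuousLinearMap.toContinuousLinearEquivOfDetNeZero (fderiv ℝ F z) hz with hf'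
  have hs : HasStrictFDerivAt F (f' : Euc d →L[ℝ] Euc d) z := by
    have := hF.contDiffAt.hasStrictFDerivAt (x := z) one_ne_zero
    rwa [hf', ContinuousLinearMap.coe_toContinuousLinearEquivOfDetNeZero]
  set e := hs.toOpenPartialHomeomorph F with he
  have hdc : Continuous fun x => (fderiv ℝ F x).det :=
    ContinuousLinearMap.continuous_det.comp (hF.continuous_fderiv one_ne_zero)
  have hsign : ∀ᶠ x in 𝓝 z,
      (fderiv ℝ F x).det = Real.sign (fderiv ℝ F z).det * |(fderiv ℝ F x).det| := by
    rcases hz.lt_or_gt with h | h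
    · filter_upwards [hdc.continuousAt.eventually (gt_mem_nhds h)] with x hx
      rw [Real.sign_of_neg h, abs_of_neg hx]
      ring
    · filter_upwards [hdc.continuousAt.eventually (lt_mem_nhds h)] with x hx
      rw [Real.sign_of_pos h, abs_of_pos hx]
      ring
  have hsrc : e.source ∈ 𝓝 z := e.open_source.mem_nhds hs.mem_toOpenPartialHomeomorph_source
  obtain ⟨U, hU, hUo, hzU⟩ := _root_.mem_nhds_iff.1 (inter_mem (inter_mem hsrc hW) hsign)
  refine ⟨U, fun x hx => (hU hx).1.2, hUo, hzU, ?_, ?_, fun x hx => (hU hx).2⟩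
  · exact e.injOn.mono fun x hx => (hU hx).1.1
  · rw [← hs.map_nhds_eq_of_equiv]
    exact image_mem_map (hUo.mem_nhds hzU)

/-- The count of the nondegenerate zeros of a `C¹` map by an integral. -/
theorem exists_integral_eq_sum_sign {d : ℕ} {F : Euc d → Euc d} (hF : ContDiff ℝ 1 F)
    {Z : Finset (Euc d)} (hZ : ∀ x, F x = 0 ↔ x ∈ Z) (hdet : ∀ z ∈ Z, (fderiv ℝ F z).det ≠ 0)
    {T : ℝ} (hT : ∀ z ∈ Z, ‖z‖ < T) (R : ℝ) :
    ∃ ε₀ > 0, ∀ (φ : Euc d → ℝ) (χ : Euc d → ℝ) (c : ℝ), Continuous φ →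
      (∀ y, ε₀ ≤ ‖y‖ → φ y = 0) → (∀ x ∈ ball 0 T, χ x = c) → (∀ x ∉ closedBall 0 R, χ x = 0) →
      ∫ x, χ x * (φ (F x) * (fderiv ℝ F x).det) =
        c * ((∑ z ∈ Z, Real.sign (fderiv ℝ F z).det) * ∫ y, φ y) := by
  classical
  obtain ⟨W, hW, hWd⟩ := Z.finite_toSet.t2_separation
  have hex : ∀ z : Euc d, ∃ U : Set (Euc d), z ∈ Z → U ⊆ W z ∩ ball 0 T ∧ IsOpen U ∧ z ∈ U ∧
      InjOn F U ∧ F '' U ∈ 𝓝 (0 : Euc d) ∧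
      ∀ x ∈ U, (fderiv ℝ F x).det = Real.sign (fderiv ℝ F z).det * |(fderiv ℝ F x).det| := by
    intro z
    by_cases hz : z ∈ Z
    · obtain ⟨U, h1, h2, h3, h4, h5, h6⟩ := exists_injOn_nhds hF (hdet z hz)
        (W := W z ∩ ball 0 T) (inter_mem ((hW z).2.mem_nhds (hW z).1)
          (isOpen_ball.mem_nhds (by simpa using hT z hz)))
      rw [(hZ z).2 hz] at h5
      exact ⟨U, fun _ => ⟨h1, h2, h3, h4, h5, h6⟩⟩
    · exact ⟨∅, fun h => absurd h hz⟩
  choose U hU using hex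
  have hUo : IsOpen (⋃ z ∈ Z, U z) := isOpen_biUnion fun z hz => (hU z hz).2.1
  have hK : IsCompact (closedBall (0 : Euc d) R \ ⋃ z ∈ Z, U z) :=
    (isCompact_closedBall 0 R).diff hUo
  -- With `φ` supported below `ε₁`, the function `φ ∘ F` vanishes on the closed ball away from the
  -- chosen neighbourhoods of the zeros; outside the ball `χ` vanishes.
  obtain ⟨ε₁, hε₁, h1⟩ : ∃ ε₁ > 0, ∀ x ∈ closedBall (0 : Euc d) R \ ⋃ z ∈ Z, U z, ε₁ ≤ ‖F x‖ := by
    rcases (closedBall (0 : Euc d) R \ ⋃ z ∈ Z, U z).eq_empty_or_nonempty with h | h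
    · exact ⟨1, one_pos, by simp [h]⟩
    · obtain ⟨x₀, hx₀, hmin⟩ := hK.exists_isMinOn h hF.continuous.norm.continuousOn
      refine ⟨‖F x₀‖, norm_pos_iff.2 fun h0 => hx₀.2 ?_, fun x hx => hmin hx⟩
      have := (hZ x₀).1 h0
      exact mem_biUnion this (hU x₀ this).2.2.1
  -- Below `ε₂` the support of `φ` lies in the image of every `U z`, so each zero contributes the
  -- whole of `∫ φ`, up to sign. Neither bound depends on `φ` or `χ`.
  obtain ⟨ε₂, hε₂, h2⟩ : ∃ ε₂ > 0, ball (0 : Euc d) ε₂ ⊆ ⋂ z ∈ Z, F '' U z :=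
    Metric.mem_nhds_iff.1 ((biInter_finset_mem Z).2 fun z hz => (hU z hz).2.2.2.2.1)
  refine ⟨min ε₁ ε₂, lt_min hε₁ hε₂, fun φ χ c hφ hφ0 hχ1 hχ0 => ?_⟩
  have hdc : Continuous fun x => (fderiv ℝ F x).det :=
    ContinuousLinearMap.continuous_det.comp (hF.continuous_fderiv one_ne_zero)
  have hpt : ∀ x, χ x * (φ (F x) * (fderiv ℝ F x).det) =
      ∑ z ∈ Z, (U z).indicator (fun x => c * (φ (F x) * (fderiv ℝ F x).det)) x := by
    intro x
    by_cases hx : ∃ z ∈ Z, x ∈ U z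
    · obtain ⟨z, hz, hxz⟩ := hx
      rw [Finset.sum_eq_single z, indicator_of_mem hxz, hχ1 x ((hU z hz).1 hxz).2]
      · intro w hw hwz
        refine indicator_of_notMem (fun hxw => ?_) _
        exact (disjoint_left.1 (hWd hw hz hwz)) ((hU w hw).1 hxw).1 ((hU z hz).1 hxz).1
      · exact fun h => absurd hz h
    · have hx' : x ∉ ⋃ z ∈ Z, U z := by simpa using hx
      rw [Finset.sum_eq_zero fun z hz => indicator_of_notMem (fun h => hx ⟨z, hz, h⟩) _]
      by_cases hxR : x ∈ closedBall (0 : Euc d) R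
      · rw [hφ0 _ ((min_le_left _ _).trans (h1 x ⟨hxR, hx'⟩))]
        simp
      · rw [hχ0 x hxR, zero_mul]
  simp_rw [hpt]
  rw [integral_finsetSum]
  · rw [Finset.sum_mul, Finset.mul_sum]
    refine Finset.sum_congr rfl fun z hz => ?_
    obtain ⟨hz1, hz2, hz3, hz4, hz5, hz6⟩ := hU z hz
    rw [integral_indicator hz2.measurableSet, integral_const_mul]
    congr 1
    have hcv := integral_image_eq_integral_abs_det_fderiv_smul volume hz2.measurableSet
      (fun x _ => ((hF.differentiable one_ne_zero) x).hasFDerivAt.hasFDerivWithinAt) hz4 φ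
    rw [setIntegral_eq_integral_of_forall_compl_eq_zero] at hcv
    · rw [hcv, ← integral_const_mul]
      refine setIntegral_congr_fun hz2.measurableSet fun x hx => ?_
      simp only [smul_eq_mul]
      conv_lhs => rw [hz6 x hx]
      ring
    · intro y hy
      apply hφ0
      refine (min_le_right _ _).trans (not_lt.1 fun h => hy ?_)
      exact mem_iInter₂.1 (h2 (by simpa using h)) z hz
  · intro z hz
    rw [integrable_indicator_iff (hU z hz).2.1.measurableSet]
    refine (ContinuousOn.integrableOn_compact (isCompact_closedBall (0 : Euc d) T) ?_).mono_set
      fun x hx => ball_subset_closedBall ((hU z hz).1 hx).2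
    exact (continuous_const.mul ((hφ.comp hF.continuous).mul hdc)).continuousOn

/-! ### Polar integration, the kernel `y / ‖y‖ ^ d` and radial cutoffs. -/

instance (d : ℕ) : IsFiniteMeasure (surfaceMeasure d) := by
  unfold surfaceMeasure; infer_instance

/-- Integration in polar coordinates. -/
theorem integral_polar {m : ℕ} {g : Euc (m + 1) → ℝ} (hg : Integrable g) :
    ∫ x, g x = ∫ r in Ioi (0 : ℝ), r ^ m *
      ∫ ξ, g (r • (ξ : Euc (m + 1))) ∂(surfaceMeasure (m + 1)) := by
  have hdim : Module.finrank ℝ (Euc (m + 1)) - 1 = m := by simp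
  have hmp := (volume : Measure (Euc (m + 1))).measurePreserving_homeomorphUnitSphereProd
  rw [hdim] at hmp
  have hemb := (homeomorphUnitSphereProd (Euc (m + 1))).measurableEmbedding
  set G : USphere (m + 1) × Ioi (0 : ℝ) → ℝ := fun q => g ((q.2 : ℝ) • (q.1 : Euc (m + 1)))
    with hG
  have hGe : ∀ x : ({0}ᶜ : Set (Euc (m + 1))), G (homeomorphUnitSphereProd _ x) = g x := by
    intro x
    have hx : ‖(x : Euc (m + 1))‖ ≠ 0 := norm_ne_zero_iff.2 x.2
    simp [hG, smul_smul, mul_inv_cancel₀ hx]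
  have hGi : Integrable G ((volume : Measure (Euc (m + 1))).toSphere.prod
      (Measure.volumeIoiPow m)) := by
    rw [← hmp.integrable_comp_emb hemb]
    have : (G ∘ homeomorphUnitSphereProd (Euc (m + 1))) = g ∘ Subtype.val := funext hGe
    rw [this, ← integrableOn_iff_comap_subtypeVal (measurableSet_singleton _).compl]
    exact hg.integrableOn
  calc ∫ x, g x = ∫ x : ({0}ᶜ : Set (Euc (m + 1))), g x ∂(volume.comap Subtype.val) := by
        rw [integral_subtype_comap (measurableSet_singleton _).compl, restrict_compl_singleton]
    _ = ∫ q, G q ∂((volume : Measure (Euc (m + 1))).toSphere.prod (Measure.volumeIoiPow m)) := by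
        rw [← hmp.integral_comp hemb]
        simp_rw [hGe]
    _ = ∫ r, ∫ ξ, G (ξ, r) ∂(surfaceMeasure (m + 1)) ∂(Measure.volumeIoiPow m) :=
        integral_prod_symm _ hGi
    _ = _ := by
        simp only [Measure.volumeIoiPow, ENNReal.ofReal]
        rw [integral_withDensity_eq_integral_smul,
          integral_subtype_comap measurableSet_Ioi fun a : ℝ ↦ Real.toNNReal (a ^ m) •
            ∫ ξ, g (a • (ξ : Euc (m + 1))) ∂(surfaceMeasure (m + 1)),
          setIntegral_congr_fun measurableSet_Ioi fun x hx ↦ ?_]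
        · rw [NNReal.smul_def, Real.coe_toNNReal _ (pow_nonneg (le_of_lt hx) _), smul_eq_mul]
        · exact (measurable_subtype_coe.pow_const _).real_toNNReal

/-- The divergence of a multiple of the position vector. -/
theorem divergence_smul_id {d : ℕ} {k : Euc d → ℝ} {y : Euc d} (hk : DifferentiableAt ℝ k y) :
    divergence (fun y => k y • y) y = d * k y + fderiv ℝ k y y := by
  have h : ∀ i, fderiv ℝ (fun y => k y • y) y (EuclideanSpace.single i 1) i =
      k y + y i * fderiv ℝ k y (EuclideanSpace.single i 1) := by
    intro i
    rw [fderiv_fun_smul hk differentiableAt_fun_id]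
    simp [mul_comm]
  have hy : y = ∑ k, y k • EuclideanSpace.single k (1 : ℝ) := by
    simpa using ((EuclideanSpace.basisFun (Fin d) ℝ).sum_repr y).symm
  have h2 : fderiv ℝ k y y = ∑ i, y i * fderiv ℝ k y (EuclideanSpace.single i 1) := by
    conv_lhs => arg 2; rw [hy]
    rw [map_sum]
    simp only [map_smul, smul_eq_mul]
  simp only [divergence, h, Finset.sum_add_distrib, h2]
  simp

/-- The field `y / ‖y‖ ^ d` is free of divergence off the origin. -/
theorem divergence_inverse_power {d : ℕ} {y : Euc d} (hy : y ≠ 0) :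
    divergence (fun y : Euc d => (‖y‖ ^ d)⁻¹ • y) y = 0 := by
  have hy' : ‖y‖ ≠ 0 := norm_ne_zero_iff.2 hy
  have hk : DifferentiableAt ℝ (fun y : Euc d => (‖y‖ ^ d)⁻¹) y :=
    (((contDiffAt_norm ℝ hy).differentiableAt one_ne_zero).pow d).inv (pow_ne_zero _ hy')
  rw [divergence_smul_id hk]
  -- Euler's identity: the radial derivative of `‖y‖ ^ (-d)`, homogeneous of degree `-d`, is `-d *
  -- ‖y‖ ^ (-d)`, which cancels the term `d * k y` of the divergence.
  have h1 : HasDerivAt (fun s : ℝ => s • y) y 1 := by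
    simpa using (hasDerivAt_id (1 : ℝ)).smul_const y
  have h2 : HasDerivAt (fun s : ℝ => (‖s • y‖ ^ d)⁻¹) (fderiv ℝ (fun y : Euc d => (‖y‖ ^ d)⁻¹) y y)
      1 := by
    have hk' : HasFDerivAt (fun y : Euc d => (‖y‖ ^ d)⁻¹)
        (fderiv ℝ (fun y : Euc d => (‖y‖ ^ d)⁻¹) y) ((fun s : ℝ => s • y) 1) := by
      simpa using hk.hasFDerivAt
    exact hk'.comp_hasDerivAt (1 : ℝ) h1
  have h3 : HasDerivAt (fun s : ℝ => (s ^ d)⁻¹ * (‖y‖ ^ d)⁻¹) (-d * (‖y‖ ^ d)⁻¹) 1 := by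
    have := ((hasDerivAt_pow d (1 : ℝ)).inv (by simp)).mul_const ((‖y‖ ^ d)⁻¹)
    simpa using this
  have h4 : (fun s : ℝ => (‖s • y‖ ^ d)⁻¹) =ᶠ[𝓝 1] fun s => (s ^ d)⁻¹ * (‖y‖ ^ d)⁻¹ := by
    filter_upwards [lt_mem_nhds (zero_lt_one' ℝ)] with s hs
    rw [norm_smul, Real.norm_of_nonneg hs.le, mul_pow, mul_inv]
  rw [h2.unique (h3.congr_of_eventuallyEq h4)]
  ring

/-- A smooth field that agrees with `y / ‖y‖ ^ d` off a small ball. -/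
theorem exists_kernel (d : ℕ) {ε : ℝ} (hε : 0 < ε) :
    ∃ V : Euc d → Euc d, ContDiff ℝ 1 V ∧ (∀ y, ε ≤ ‖y‖ → V y = (‖y‖ ^ d)⁻¹ • y) ∧
      ∀ y, ε ≤ ‖y‖ → divergence V y = 0 := by
  -- The outer radius `ε / 2` lies strictly below `ε`, so the fields agree in a neighbourhood of
  -- each point with `ε ≤ ‖y‖` and their divergences agree there too.
  set b : ContDiffBump (0 : Euc d) := ⟨ε / 4, ε / 2, by linarith, by linarith⟩ with hb
  have hVy : ∀ y, ε / 2 < ‖y‖ → (1 - b y) • ((‖y‖ ^ d)⁻¹ • y) = (‖y‖ ^ d)⁻¹ • y := by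
    intro y hy
    rw [b.zero_of_le_dist (by simpa using hy.le), sub_zero, one_smul]
  refine ⟨fun y => (1 - b y) • ((‖y‖ ^ d)⁻¹ • y), ?_, fun y hy => hVy y (by linarith), ?_⟩
  · rw [contDiff_iff_contDiffAt]
    intro y
    by_cases hy : y = 0
    · have : (fun y => (1 - b y) • ((‖y‖ ^ d)⁻¹ • y)) =ᶠ[𝓝 y] fun _ => 0 := by
        have hmem : ball (0 : Euc d) (ε / 4) ∈ 𝓝 y :=
          isOpen_ball.mem_nhds (by rw [hy]; exact mem_ball_self (by linarith))
        filter_upwards [hmem] with z hz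
        rw [b.one_of_mem_closedBall (ball_subset_closedBall hz), sub_self, zero_smul]
      exact contDiffAt_const.congr_of_eventuallyEq this
    · have hy' : ‖y‖ ≠ 0 := norm_ne_zero_iff.2 hy
      have h1 : ContDiffAt ℝ 1 (fun y : Euc d => (‖y‖ ^ d)⁻¹) y :=
        ContDiffAt.inv ((contDiffAt_norm ℝ hy).pow d) (pow_ne_zero _ hy')
      have h2 : ContDiffAt ℝ 1 (fun y : Euc d => 1 - b y) y := contDiffAt_const.sub b.contDiffAt
      exact h2.smul (h1.smul contDiffAt_id)
  · intro y hy
    have hy0 : y ≠ 0 := by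
      rintro rfl
      simp at hy
      linarith
    have : (fun y => (1 - b y) • ((‖y‖ ^ d)⁻¹ • y)) =ᶠ[𝓝 y] fun y => (‖y‖ ^ d)⁻¹ • y := by
      filter_upwards [continuous_norm.continuousAt.eventually
        (lt_mem_nhds (show ε / 2 < ‖y‖ by linarith))] with z hz using hVy z hz
    rw [divergence, this.fderiv_eq]
    exact divergence_inverse_power hy0

theorem fderiv_norm_apply_single {d : ℕ} {x : Euc d} (hx : x ≠ 0) (j : Fin d) :
    fderiv ℝ (fun y : Euc d => ‖y‖) x (EuclideanSpace.single j 1) = ‖x‖⁻¹ * x j := by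
  have hx' : ‖x‖ ≠ 0 := norm_ne_zero_iff.2 hx
  have hd : DifferentiableAt ℝ (fun y : Euc d => ‖y‖) x :=
    (contDiffAt_norm ℝ hx).differentiableAt one_ne_zero
  have h1 := (hd.hasFDerivAt.pow 2).unique (hasStrictFDerivAt_norm_sq x).hasFDerivAt
  have h2 := congrArg (fun L : Euc d →L[ℝ] ℝ => L (EuclideanSpace.single j 1)) h1
  have h3 : inner ℝ x (EuclideanSpace.single j (1 : ℝ)) = x j := by
    simp [EuclideanSpace.inner_single_right]
  simp [h3] at h2
  field_simp
  linarith

/-- The radial antiderivative of a test function on a half-line. -/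
theorem exists_radial_antiderivative {d : ℕ} {T : ℝ} (hT : 0 < T) {ψ : ℝ → ℝ} (hψ : Continuous ψ)
    (hc : HasCompactSupport ψ) (hs : tsupport ψ ⊆ Ioi T) :
    ∃ (R : ℝ) (χ : Euc d → ℝ), ContDiff ℝ 1 χ ∧ (∀ x ∉ closedBall 0 R, χ x = 0) ∧
      (∀ x ∈ ball 0 T, χ x = ∫ r, ψ r) ∧
      ∀ x j, partials χ x j = -ψ ‖x‖ * (‖x‖⁻¹ * x j) := by
  have hψ0 : ∀ r ≤ T, ψ r = 0 := fun r hr =>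
    image_eq_zero_of_notMem_tsupport fun h => (not_lt.2 hr) (hs h)
  obtain ⟨R, hRT, hR⟩ := hc.isCompact.isBounded.subset_ball_lt T (0 : ℝ)
  have hψR : ∀ r, R ≤ r → ψ r = 0 := fun r hr =>
    image_eq_zero_of_notMem_tsupport fun h => by
      have := hR h
      simp only [mem_ball, dist_zero_right, Real.norm_eq_abs] at this
      linarith [le_abs_self r]
  -- Integrating from `r` up to `R` makes `X` vanish beyond `R` and equal `∫ ψ` below `T`. Being
  -- constant there, `X ‖x‖` is `C¹` even at the origin, where the norm is not.
  set X : ℝ → ℝ := fun r => ∫ s in r..R, ψ s with hX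
  have hXd : ∀ r, HasDerivAt X (-ψ r) r := fun r =>
    intervalIntegral.integral_hasDerivAt_left (hψ.intervalIntegrable _ _)
      (hψ.stronglyMeasurableAtFilter _ _) hψ.continuousAt
  have hXC : ContDiff ℝ 1 X := by
    rw [contDiff_one_iff_deriv]
    refine ⟨fun r => (hXd r).differentiableAt, ?_⟩
    rw [show deriv X = fun r => -ψ r from funext fun r => (hXd r).deriv]
    exact hψ.neg
  have hX0 : ∀ r, R ≤ r → X r = 0 := by
    intro r hr
    rw [hX]
    refine (intervalIntegral.integral_congr (g := fun _ => 0) fun s hs => ?_).trans (by simp)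
    rw [uIcc_of_ge hr] at hs
    exact hψR s hs.1
  have hX1 : ∀ r ≤ T, X r = ∫ r, ψ r := by
    intro r hr
    refine intervalIntegral.integral_eq_integral_of_support_subset fun s hs => ?_
    by_contra h
    rw [mem_Ioc, not_and_or] at h
    rcases h with h | h
    · exact hs (hψ0 s (by linarith))
    · exact hs (hψR s (by linarith))
  have hloc : ∀ x ∈ ball (0 : Euc d) T, (fun x : Euc d => X ‖x‖) =ᶠ[𝓝 x] fun _ => ∫ r, ψ r := by
    intro x hx
    filter_upwards [isOpen_ball.mem_nhds hx] with y hy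
    exact hX1 _ (by simpa using (mem_ball_zero_iff.1 hy).le)
  refine ⟨R, fun x => X ‖x‖, ?_, ?_, ?_, ?_⟩
  · rw [contDiff_iff_contDiffAt]
    intro x
    by_cases hx : x = 0
    · exact contDiffAt_const.congr_of_eventuallyEq (hloc x (by simpa [hx] using hT))
    · exact hXC.contDiffAt.comp x (contDiffAt_norm ℝ hx)
  · intro x hx
    exact hX0 _ (by simpa using (not_le.1 (by simpa using hx)).le)
  · intro x hx
    exact hX1 _ (mem_ball_zero_iff.1 hx).le
  · intro x j
    by_cases hx : x = 0
    · rw [partials, (hloc x (by simpa [hx] using hT)).fderiv_eq]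
      simp [hx]
    · have hd : DifferentiableAt ℝ (fun y : Euc d => ‖y‖) x :=
        (contDiffAt_norm ℝ hx).differentiableAt one_ne_zero
      have : HasFDerivAt (fun x : Euc d => X ‖x‖) (-ψ ‖x‖ • fderiv ℝ (fun y : Euc d => ‖y‖) x) x :=
        (hXd ‖x‖).comp_hasFDerivAt x hd.hasFDerivAt
      rw [partials, this.fderiv, ← fderiv_norm_apply_single hx]
      simp

/-! ### The winding integral as a function of the radius. -/

/-- The density of the winding number of the restriction of `F` to the sphere of radius `r`, as a
function on the unit sphere. -/
def sphereDensity {m : ℕ} (F : Euc (m + 1) → Euc (m + 1)) (r : ℝ) (ξ : USphere (m + 1)) : ℝ :=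
  r ^ m * ((‖F (r • (ξ : Euc (m + 1)))‖ ^ (m + 1))⁻¹ * ∑ i, F (r • (ξ : Euc (m + 1))) i *
    ((stdMatrix (fderiv ℝ F (r • (ξ : Euc (m + 1))))).updateRow i
      (fun j => (ξ : Euc (m + 1)) j)).det)

/-- Integration of the winding number against a test function. -/
theorem exists_integral_sphereDensity_eq {m : ℕ} {F : Euc (m + 1) → Euc (m + 1)}
    (hF : ContDiff ℝ 1 F) {Z : Finset (Euc (m + 1))} (hZ : ∀ x, F x = 0 ↔ x ∈ Z)
    (hdet : ∀ z ∈ Z, (fderiv ℝ F z).det ≠ 0) {T : ℝ} (hT : 0 < T) (hZT : ∀ z ∈ Z, ‖z‖ < T)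
    {ψ : ℝ → ℝ} (hψ : Continuous ψ) (hψc : HasCompactSupport ψ) (hψs : tsupport ψ ⊆ Ioi T) :
    ∃ ε₀ > 0, ∀ ε ≤ ε₀, ∀ V : Euc (m + 1) → Euc (m + 1), ContDiff ℝ 1 V →
      (∀ y, ε ≤ ‖y‖ → V y = (‖y‖ ^ (m + 1))⁻¹ • y) → (∀ y, ε ≤ ‖y‖ → divergence V y = 0) →
      ∫ r in Ioi (0 : ℝ), ψ r * ∫ ξ, sphereDensity F r ξ ∂(surfaceMeasure (m + 1)) =
        (∫ r, ψ r) * ((∑ z ∈ Z, Real.sign (fderiv ℝ F z).det) * ∫ y, divergence V y) := by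
  obtain ⟨R, χ, hχ, hχ0, hχ1, hχp⟩ :=
    exists_radial_antiderivative (d := m + 1) hT hψ hψc hψs
  have hχc : HasCompactSupport χ := HasCompactSupport.intro (isCompact_closedBall 0 R) hχ0
  obtain ⟨ε₁, hε₁, h1⟩ := exists_integral_eq_sum_sign hF hZ hdet hZT R
  -- On the spheres with radius in the support of `ψ`, which enclose all zeros, `‖F‖` is bounded
  -- below by `ε₂`; so `V ∘ F` there is given by the explicit kernel.
  obtain ⟨ε₂, hε₂, h2⟩ : ∃ ε₂ > 0, ∀ x : Euc (m + 1), ‖x‖ ∈ tsupport ψ → ε₂ ≤ ‖F x‖ := by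
    have hK : IsCompact ((fun x : Euc (m + 1) => ‖x‖) ⁻¹' tsupport ψ) := by
      refine Metric.isCompact_of_isClosed_isBounded
        ((isClosed_tsupport ψ).preimage continuous_norm) ?_
      obtain ⟨r, hr⟩ := hψc.isCompact.isBounded.subset_closedBall (0 : ℝ)
      refine (isBounded_closedBall (x := (0 : Euc (m + 1))) (r := r)).subset fun x hx => ?_
      simpa using hr hx
    rcases ((fun x : Euc (m + 1) => ‖x‖) ⁻¹' tsupport ψ).eq_empty_or_nonempty with h | h
    · exact ⟨1, one_pos, fun x hx => (eq_empty_iff_forall_notMem.1 h x hx).elim⟩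
    · obtain ⟨x₀, hx₀, hmin⟩ := hK.exists_isMinOn h hF.continuous.norm.continuousOn
      refine ⟨‖F x₀‖, norm_pos_iff.2 fun h0 => ?_, fun x hx => hmin hx⟩
      exact lt_asymm (hψs hx₀) (hZT x₀ ((hZ x₀).1 h0))
  refine ⟨min ε₁ ε₂, lt_min hε₁ hε₂, fun ε hε V hV hVy hVdiv => ?_⟩
  have hdivc : Continuous (divergence V) := by
    refine continuous_finsetSum _ fun i _ => ?_
    have := hV.continuous_fderiv one_ne_zero
    fun_prop
  have hdetc : Continuous fun x => (fderiv ℝ F x).det :=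
    ContinuousLinearMap.continuous_det.comp (hF.continuous_fderiv one_ne_zero)
  have hB := h1 (divergence V) χ (∫ r, ψ r) hdivc
    (fun y hy => hVdiv y (hε.trans ((min_le_left _ _).trans hy))) hχ1 hχ0
  have hBi : Integrable fun x => χ x * (divergence V (F x) * (fderiv ℝ F x).det) :=
    (hχ.continuous.mul ((hdivc.comp hF.continuous).mul hdetc)).integrable_of_hasCompactSupport
      hχc.mul_right
  set A : Euc (m + 1) → ℝ := fun x =>
    ∑ i, V (F x) i * ((stdMatrix (fderiv ℝ F x)).updateRow i (partials χ x)).det with hA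
  have hAi : Integrable A := by
    refine Continuous.integrable_of_hasCompactSupport ?_
      (HasCompactSupport.intro hχc.isCompact fun x hx => ?_)
    · have hM : Continuous fun x => stdMatrix (fderiv ℝ F x) :=
        continuous_stdMatrix.comp (hF.continuous_fderiv one_ne_zero)
      have hp : Continuous (partials χ) := by
        refine continuous_pi fun j => ?_
        have := hχ.continuous_fderiv one_ne_zero
        unfold partials
        fun_prop
      exact continuous_finsetSum _ fun i _ => ((hV.comp hF).coord i).continuous.mul
        (hM.matrix_updateRow i hp).matrix_det
    · have h0 : fderiv ℝ χ x = 0 := image_eq_zero_of_notMem_tsupport fun h =>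
        hx (tsupport_fderiv_subset ℝ h)
      refine Finset.sum_eq_zero fun i _ => ?_
      rw [Matrix.det_eq_zero_of_row_eq_zero i fun j => by simp [partials, h0], mul_zero]
  -- The cutoff has gradient `-ψ ‖x‖ * x / ‖x‖`, so in polar coordinates the first term is minus the
  -- average of the winding integrals with weight `ψ`. The second term is the count `hB`.
  have hnull := integral_null_lagrangian (Nat.succ_ne_zero m) hF hV hχ hχc
  rw [integral_add hAi hBi, hB, integral_polar hAi] at hnull
  rw [← neg_eq_of_add_eq_zero_right hnull, ← integral_neg]
  refine setIntegral_congr_fun measurableSet_Ioi fun r hr => ?_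
  have hr' : 0 < r := hr
  rw [← mul_neg, ← integral_neg, ← integral_const_mul, ← integral_const_mul]
  refine integral_congr_ae (.of_forall fun ξ => ?_)
  have hξ : ‖(ξ : Euc (m + 1))‖ = 1 := by simp
  have hn : ‖r • (ξ : Euc (m + 1))‖ = r := by rw [norm_smul, hξ, mul_one, Real.norm_of_nonneg hr'.le]
  have hpart : partials χ (r • (ξ : Euc (m + 1))) = -ψ r • fun j => (ξ : Euc (m + 1)) j := by
    funext j
    rw [hχp, hn]
    simp [hr'.ne']
  simp only [hA, hpart, Matrix.det_updateRow_smul, sphereDensity]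
  by_cases hψr : ψ r = 0
  · simp [hψr]
  · have hle : ε ≤ ‖F (r • (ξ : Euc (m + 1)))‖ :=
      hε.trans ((min_le_right _ _).trans (h2 _ (hn.symm ▸ subset_tsupport _ hψr)))
    rw [hVy _ hle, Finset.mul_sum, Finset.mul_sum, Finset.mul_sum, ← Finset.sum_neg_distrib,
      Finset.mul_sum]
    refine Finset.sum_congr rfl fun i _ => ?_
    simp only [PiLp.smul_apply, smul_eq_mul]
    ring

/-- The normalization: for the identity, which has one zero of sign `1`, the winding integral is the
area of the sphere. This determines `∫ div V` without computing it. -/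
theorem sphereDensity_id {m : ℕ} {r : ℝ} (hr : 0 < r) (ξ : USphere (m + 1)) :
    sphereDensity id r ξ = 1 := by
  have hξ : ‖(ξ : Euc (m + 1))‖ = 1 := by simp
  have hn : ‖r • (ξ : Euc (m + 1))‖ = r := by rw [norm_smul, hξ, mul_one, Real.norm_of_nonneg hr.le]
  have hM : stdMatrix (ContinuousLinearMap.id ℝ (Euc (m + 1))) = 1 := by
    ext i j
    simp [stdMatrix, Matrix.one_apply]
  have hdet : ∀ i, ((1 : Matrix (Fin (m + 1)) (Fin (m + 1)) ℝ).updateRow i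
      (fun j => (ξ : Euc (m + 1)) j)).det = (ξ : Euc (m + 1)) i := by
    intro i
    rw [← Matrix.cramer_transpose_apply]
    simp
  have hsq : ∑ i, (ξ : Euc (m + 1)) i * (ξ : Euc (m + 1)) i = 1 := by
    have := EuclideanSpace.real_norm_sq_eq (ξ : Euc (m + 1))
    rw [hξ] at this
    simp_rw [← sq]
    linarith
  rw [sphereDensity]
  simp only [id, hn, fderiv_id, hM, hdet, PiLp.smul_apply, smul_eq_mul, mul_assoc]
  rw [← Finset.mul_sum, hsq]
  field_simp
  ring

/-- The winding number on spheres that enclose all zeros, as a distribution in the radius. -/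
theorem integral_mul_sphereDensity_eq {m : ℕ} {F : Euc (m + 1) → Euc (m + 1)}
    (hF : ContDiff ℝ 1 F) {Z : Finset (Euc (m + 1))} (hZ : ∀ x, F x = 0 ↔ x ∈ Z)
    (hdet : ∀ z ∈ Z, (fderiv ℝ F z).det ≠ 0) {T : ℝ} (hT : 0 < T) (hZT : ∀ z ∈ Z, ‖z‖ < T)
    {ψ : ℝ → ℝ} (hψ : Continuous ψ) (hψc : HasCompactSupport ψ) (hψs : tsupport ψ ⊆ Ioi T) :
    ∫ r in Ioi (0 : ℝ), ψ r * ∫ ξ, sphereDensity F r ξ ∂(surfaceMeasure (m + 1)) =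
      (∫ r, ψ r) * ((∑ z ∈ Z, Real.sign (fderiv ℝ F z).det) *
        (surfaceMeasure (m + 1)).real univ) := by
  obtain ⟨ε₁, hε₁, h1⟩ := exists_integral_sphereDensity_eq hF hZ hdet hT hZT hψ hψc hψs
  have hid : ∀ z ∈ ({0} : Finset (Euc (m + 1))), (fderiv ℝ id z).det = 1 := by
    intro z _
    rw [fderiv_id]
    simp [ContinuousLinearMap.det]
  obtain ⟨ε₂, hε₂, h2⟩ := exists_integral_sphereDensity_eq (m := m) (F := id) (Z := {0}) contDiff_id
    (by simp) (fun z hz => by rw [hid z hz]; exact one_ne_zero) hT (by simpa using hT) hψ hψc hψs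
  -- One field `V` serves both `F` and the identity, so the factor `∫ div V` can be eliminated
  -- between the two identities.
  obtain ⟨V, hV, hVy, hVd⟩ := exists_kernel (m + 1) (lt_min hε₁ hε₂)
  have e1 := h1 _ (min_le_left _ _) V hV hVy hVd
  have e2 := h2 _ (min_le_right _ _) V hV hVy hVd
  rw [Finset.sum_singleton, hid 0 (by simp), Real.sign_one, one_mul] at e2
  have hψ0 : ∀ r ∉ Ioi (0 : ℝ), ψ r = 0 := fun r hr =>
    image_eq_zero_of_notMem_tsupport fun h => hr (hT.trans (hψs h))
  have e3 : ∫ r in Ioi (0 : ℝ), ψ r * ∫ ξ, sphereDensity id r ξ ∂(surfaceMeasure (m + 1)) =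
      (∫ r, ψ r) * (surfaceMeasure (m + 1)).real univ := by
    have e4 : ∫ r in Ioi (0 : ℝ), ψ r * (surfaceMeasure (m + 1)).real univ =
        ∫ r, ψ r * (surfaceMeasure (m + 1)).real univ :=
      setIntegral_eq_integral_of_forall_compl_eq_zero fun r hr => by rw [hψ0 r hr, zero_mul]
    rw [← integral_mul_const, ← e4]
    refine setIntegral_congr_fun measurableSet_Ioi fun r hr => ?_
    simp_rw [sphereDensity_id hr]
    simp
  rw [e1, mul_left_comm, ← e2, e3]
  ring

theorem continuous_sphereDensity {m : ℕ} {F : Euc (m + 1) → Euc (m + 1)}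
    (hF : ContDiff ℝ 1 F) {T : ℝ} (hT : 0 < T) (hne : ∀ x, T < ‖x‖ → F x ≠ 0) :
    Continuous fun q : Ioi T × USphere (m + 1) => sphereDensity F q.1 q.2 := by
  have hx : Continuous fun q : Ioi T × USphere (m + 1) =>
      (q.1 : ℝ) • (q.2 : Euc (m + 1)) := by fun_prop
  have hM : Continuous fun q : Ioi T × USphere (m + 1) =>
      stdMatrix (fderiv ℝ F ((q.1 : ℝ) • (q.2 : Euc (m + 1)))) :=
    continuous_stdMatrix.comp ((hF.continuous_fderiv one_ne_zero).comp hx)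
  have hFx := hF.continuous.comp hx
  have hξ : Continuous fun q : Ioi T × USphere (m + 1) => fun j => (q.2 : Euc (m + 1)) j := by
    fun_prop
  unfold sphereDensity
  refine Continuous.mul (by fun_prop) (Continuous.mul ?_ ?_)
  · refine Continuous.inv₀ (hFx.norm.pow _) fun q => pow_ne_zero _ (norm_ne_zero_iff.2 (hne _ ?_))
    have : ‖(q.2 : Euc (m + 1))‖ = 1 := by simp
    rw [norm_smul, this, mul_one, Real.norm_of_nonneg (hT.trans q.1.2).le]
    exact q.1.2
  · exact continuous_finsetSum _ fun i _ => (((hF.coord i).continuous).comp hx).mul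
      (hM.matrix_updateRow i hξ).matrix_det

/-- On spheres that enclose all zeros, the integral of the winding density counts the zeros. -/
theorem integral_sphereDensity_eq {m : ℕ} {F : Euc (m + 1) → Euc (m + 1)}
    (hF : ContDiff ℝ 1 F) {Z : Finset (Euc (m + 1))} (hZ : ∀ x, F x = 0 ↔ x ∈ Z)
    (hdet : ∀ z ∈ Z, (fderiv ℝ F z).det ≠ 0) {T : ℝ} (hT : 0 < T) (hZT : ∀ z ∈ Z, ‖z‖ < T)
    {r : ℝ} (hr : T < r) :
    ∫ ξ, sphereDensity F r ξ ∂(surfaceMeasure (m + 1)) =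
      (∑ z ∈ Z, Real.sign (fderiv ℝ F z).det) * (surfaceMeasure (m + 1)).real univ := by
  set N := (∑ z ∈ Z, Real.sign (fderiv ℝ F z).det) * (surfaceMeasure (m + 1)).real univ with hN
  set W : ℝ → ℝ := fun r => ∫ ξ, sphereDensity F r ξ ∂(surfaceMeasure (m + 1)) with hW
  have hWc : ContinuousOn W (Ioi T) := by
    rw [continuousOn_iff_continuous_domRestrict]
    have h := continuous_sphereDensity hF hT fun x hx h0 =>
      lt_asymm hx (hZT x ((hZ x).1 h0))
    have : LocallyCompactSpace (Ioi T) := isOpen_Ioi.locallyCompactSpace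
    have := continuous_parametric_integral_of_continuous (μ := surfaceMeasure (m + 1))
      (f := fun (r : Ioi T) (ξ : USphere (m + 1)) => sphereDensity F r ξ) h isCompact_univ
    simp only [Measure.restrict_univ] at this
    exact this
  -- The averaged identity says that `W - N` is zero as a distribution on `(T, ∞)`, hence almost
  -- everywhere; continuity of `W` then removes the exceptional set.
  have hae : ∀ᵐ r : ℝ, r ∈ Ioi T → W r - N = 0 := by
    refine isOpen_Ioi.ae_eq_zero_of_integral_contDiff_smul_eq_zero
      ((hWc.sub continuousOn_const).locallyIntegrableOn measurableSet_Ioi) ?_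
    intro ψ hψ hψc hψs
    have h := integral_mul_sphereDensity_eq hF hZ hdet hT hZT hψ.continuous hψc hψs
    have hψ0 : ∀ r ∉ Ioi (0 : ℝ), ψ r = 0 := fun r hr =>
      image_eq_zero_of_notMem_tsupport fun h => hr (hT.trans (hψs h))
    rw [setIntegral_eq_integral_of_forall_compl_eq_zero
      fun r hr => by rw [hψ0 r hr, zero_mul]] at h
    simp only [smul_eq_mul, mul_sub]
    rw [integral_sub, integral_mul_const, h, sub_self]
    · have hcont : Continuous fun r => ψ r * W r := by
        rw [continuous_iff_continuousAt]
        intro r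
        by_cases hr : r ∈ tsupport ψ
        · exact hψ.continuous.continuousAt.mul (hWc.continuousAt (Ioi_mem_nhds (hψs hr)))
        · refine continuousAt_const.congr_of_eventuallyEq (f := fun _ => (0 : ℝ)) ?_
          filter_upwards [(isClosed_tsupport ψ).isOpen_compl.mem_nhds hr] with s hs
          rw [image_eq_zero_of_notMem_tsupport hs, zero_mul]
      exact hcont.integrable_of_hasCompactSupport hψc.mul_right
    · exact (hψ.continuous.mul continuous_const).integrable_of_hasCompactSupport hψc.mul_right
  have := Measure.eqOn_open_of_ae_eq (μ := volume) (f := W) (g := fun _ => N)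
    ((ae_restrict_iff' measurableSet_Ioi).2 (hae.mono fun r h hr => sub_eq_zero.1 (h hr)))
    isOpen_Ioi hWc continuousOn_const
  exact this hr

/-! ### Regularity of the map in polar coordinates. -/

open Module in
/-- A map that is `C^k` on a set and takes values in the unit sphere is `C^k` on this set as a map
to the sphere. -/
theorem ContMDiffOn.codRestrict_sphere {E E' H M : Type*} [NormedAddCommGroup E]
    [InnerProductSpace ℝ E] [NormedAddCommGroup E'] [NormedSpace ℝ E'] [TopologicalSpace H]
    {I : ModelWithCorners ℝ E' H} [TopologicalSpace M] [ChartedSpace H M] {k : ℕ∞ω}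
    [IsManifold I k M] {n : ℕ} [Fact (finrank ℝ E = n + 1)] {f : M → E} {s : Set M}
    (hf : ContMDiffOn I 𝓘(ℝ, E) k f s) (hf' : ∀ x, f x ∈ sphere (0 : E) 1) :
    ContMDiffOn I (𝓡 n) k (Set.codRestrict _ _ hf' : M → sphere (0 : E) 1) s := by
  rw [contMDiffOn_iff_target]
  refine ⟨continuousOn_iff_continuous_domRestrict.2
    (continuous_induced_rng.2 (continuousOn_iff_continuous_domRestrict.1 hf.continuousOn)), ?_⟩
  intro v
  let U : _ ≃ₗᵢ[ℝ] _ :=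
    (OrthonormalBasis.fromOrthogonalSpanSingleton n (ne_zero_of_mem_unit_sphere (-v))).repr
  have h : ContDiffOn ℝ ω _ Set.univ := U.contDiff.contDiffOn
  have H₁ := (h.comp_inter contDiffOn_stereoToFun).contMDiffOn
  convert! (H₁.of_le le_top).comp' hf using 1
  ext x
  -- The chart at `v` is stereographic projection from `-v`. Its source is the complement of that
  -- pole, while the smoothness statement describes the same set by an inner product different from
  -- `1`.
  have hfxv : f x = -(v : E) ↔ inner ℝ (f x) (-(v : E)) = 1 := by
    have hfx : ‖f x‖ = 1 := by simpa using hf' x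
    rw [inner_eq_one_iff_of_norm_eq_one hfx]
    exact norm_eq_of_mem_sphere (-v)
  simp [chartAt, ChartedSpace.chartAt, Subtype.ext_iff, hfxv, real_inner_comm]

theorem ContMDiffOn.codRestrict_usphere {m : ℕ} {f : Euc (m + 1) → Euc (m + 1)}
    {s : Set (Euc (m + 1))} (hf : ContMDiffOn 𝓘(ℝ, Euc (m + 1)) 𝓘(ℝ, Euc (m + 1)) 1 f s)
    (hf' : ∀ x, f x ∈ sphere (0 : Euc (m + 1)) 1) :
    ContMDiffOn 𝓘(ℝ, Euc (m + 1)) (𝓡 m) 1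
      (Set.codRestrict _ _ hf' : Euc (m + 1) → USphere (m + 1)) s := by
  have := Fact.mk (finrank_euclideanSpace_fin (𝕜 := ℝ) (n := m + 1))
  exact hf.codRestrict_sphere hf'

/-- The map `t ξ ↦ μ (t, ξ)` in polar coordinates. -/
def polarMap {d : ℕ} (μ : ℝ → USphere d → Euc d) (x : Euc d) : Euc d := radialExt (μ ‖x‖) x

theorem polarMap_smul {d : ℕ} (μ : ℝ → USphere d → Euc d) {t : ℝ} (ht : 0 < t) (ξ : USphere d) :
    polarMap μ (t • (ξ : Euc d)) = μ t ξ := by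
  have hξ : ‖(ξ : Euc d)‖ = 1 := by simp
  have hξ0 : (ξ : Euc d) ≠ 0 := norm_ne_zero_iff.1 (by rw [hξ]; exact one_ne_zero)
  have hn : ‖t • (ξ : Euc d)‖ = t := by rw [norm_smul, hξ, mul_one, Real.norm_of_nonneg ht.le]
  have h : ∀ h', (⟨‖t • (ξ : Euc d)‖⁻¹ • t • (ξ : Euc d), h'⟩ : USphere d) = ξ := fun h' => by
    ext1
    simp [hn, smul_smul, inv_mul_cancel₀ ht.ne']
  rw [polarMap, radialExt, dif_pos (smul_ne_zero ht.ne' hξ0), h, hn]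

theorem exists_eq_smul {d : ℕ} {x : Euc d} (hx : x ≠ 0) :
    ∃ ξ : USphere d, x = ‖x‖ • (ξ : Euc d) := by
  have hx' : ‖x‖ ≠ 0 := norm_ne_zero_iff.2 hx
  exact ⟨⟨‖x‖⁻¹ • x, by simp [norm_smul, inv_mul_cancel₀ hx']⟩,
    by simp [smul_smul, mul_inv_cancel₀ hx']⟩

theorem radialExt_eq {d : ℕ} (μ : ℝ → USphere d → Euc d) {t : ℝ} (ht : 0 < t) {x : Euc d}
    (hx : x ≠ 0) : radialExt (μ t) x = polarMap μ (t • (‖x‖⁻¹ • x)) := by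
  have hx' : ‖x‖ ≠ 0 := norm_ne_zero_iff.2 hx
  rw [radialExt, dif_pos hx, ← polarMap_smul μ ht]

/-- Off the origin `x ↦ (‖x‖, x / ‖x‖)` is `C¹` into `(0, ∞) × S^m`, and `polarMap μ` is its
composite with `μ`. -/
theorem contDiffAt_polarMap {m : ℕ} {μ : ℝ → USphere (m + 1) → Euc (m + 1)}
    (hdiff : ContMDiffOn (𝓘(ℝ, ℝ).prod (𝓡 m)) 𝓘(ℝ, Euc (m + 1)) 1
      (fun q : ℝ × USphere (m + 1) => μ q.1 q.2) (Ioi 0 ×ˢ univ))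
    {x : Euc (m + 1)} (hx : x ≠ 0) : ContDiffAt ℝ 1 (polarMap μ) x := by
  classical
  -- The value at `0` is an arbitrary unit vector: restricting the codomain to the sphere needs
  -- membership at every point.
  set f : Euc (m + 1) → Euc (m + 1) := fun x =>
    if x = 0 then EuclideanSpace.single 0 1 else ‖x‖⁻¹ • x with hf
  have hf' : ∀ x, f x ∈ sphere (0 : Euc (m + 1)) 1 := by
    intro x
    rw [mem_sphere_zero_iff_norm]
    by_cases h : x = 0
    · simp [hf, h]
    · simp [hf, h, norm_smul]
  have hfC : ContDiffOn ℝ 1 f {0}ᶜ := by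
    have h : ContDiffOn ℝ 1 (fun x : Euc (m + 1) => ‖x‖⁻¹ • x) {0}ᶜ := fun x hx =>
      (((contDiffAt_norm ℝ hx).inv (norm_ne_zero_iff.2 hx)).smul contDiffAt_id).contDiffWithinAt
    exact h.congr fun x hx => by
      have : x ≠ 0 := hx
      simp [hf, this]
  have hnorm : ContDiffOn ℝ 1 (fun x : Euc (m + 1) => ‖x‖) {0}ᶜ := fun x hx =>
    (contDiffAt_norm ℝ hx).contDiffWithinAt
  have hpair : ContMDiffOn 𝓘(ℝ, Euc (m + 1)) (𝓘(ℝ, ℝ).prod (𝓡 m)) 1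
      (fun x => (‖x‖, (Set.codRestrict _ _ hf' : Euc (m + 1) → USphere (m + 1)) x)) {0}ᶜ :=
    hnorm.contMDiffOn.prodMk (hfC.contMDiffOn.codRestrict_usphere hf')
  have hcomp := (hdiff.comp hpair fun x hx => ⟨norm_pos_iff.2 hx, mem_univ _⟩).contDiffOn
  have := hcomp.contDiffAt (isOpen_compl_singleton.mem_nhds hx)
  refine this.congr_of_eventuallyEq ?_
  filter_upwards [isOpen_compl_singleton.mem_nhds hx] with y hy
  have hy0 : y ≠ 0 := hy
  simp only [polarMap, radialExt, dif_pos hy0, Function.comp]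
  congr 1
  ext1
  simp [hf, hy0]

/-! ### Linear algebra of `normalDet`. -/

/-- The orthogonal projection onto the tangent space of the sphere. -/
def tangentProj {d : ℕ} (ξ : USphere d) : Euc d →L[ℝ] Euc d :=
  1 - (innerSL ℝ (ξ : Euc d)).smulRight (ξ : Euc d)

theorem inner_sphere_self {d : ℕ} (ξ : USphere d) : inner ℝ (ξ : Euc d) (ξ : Euc d) = 1 := by
  rw [real_inner_self_eq_norm_sq]
  simp

theorem tangentProj_self {d : ℕ} (ξ : USphere d) : tangentProj ξ (ξ : Euc d) = 0 := by
  simp [tangentProj]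

theorem det_comp {d : ℕ} (A B : Euc d →L[ℝ] Euc d) : (A.comp B).det = A.det * B.det :=
  LinearMap.det_comp _ _

theorem det_smul {d : ℕ} (c : ℝ) (A : Euc d →L[ℝ] Euc d) : (c • A).det = c ^ d * A.det := by
  have := LinearMap.det_smul c (A : Euc d →ₗ[ℝ] Euc d)
  rwa [finrank_euclideanSpace_fin] at this

theorem det_one_add_smulRight {d : ℕ} (l : Euc d →L[ℝ] ℝ) (v : Euc d) :
    (1 + l.smulRight v).det = 1 + l v := by
  have h := LinearMap.transvection.det (l : Euc d →ₗ[ℝ] ℝ) v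
  rw [← ContinuousLinearMap.coe_coe l, ← h]
  congr 1

/-- A column operation: multiples of the normal column `a` are added to the tangential ones. It
discards the radial part of the derivative of `f / ‖f‖`. -/
theorem normalDet_add_smulRight {d : ℕ} (ξ : USphere d) (a : Euc d) {D : Euc d →L[ℝ] Euc d}
    (hD : D (ξ : Euc d) = 0) {l : Euc d →L[ℝ] ℝ} (hl : l (ξ : Euc d) = 0) :
    normalDet ξ a (D + l.smulRight a) = normalDet ξ a D := by
  have h : (innerSL ℝ (ξ : Euc d)).smulRight a + (D + l.smulRight a) =
      ((innerSL ℝ (ξ : Euc d)).smulRight a + D).comp (1 + l.smulRight (ξ : Euc d)) := by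
    ext1 v
    simp [hD]
    abel
  rw [normalDet, h, det_comp, det_one_add_smulRight, hl, add_zero, mul_one, normalDet]

/-- Only the `m` tangential columns are scaled. The scaling is composition with a map that is `t` on
the tangent space and `1` on the normal. -/
theorem normalDet_smul_right {m : ℕ} (ξ : USphere (m + 1)) (a : Euc (m + 1))
    {D : Euc (m + 1) →L[ℝ] Euc (m + 1)} (hD : D (ξ : Euc (m + 1)) = 0) {t : ℝ} (ht : t ≠ 0) :
    normalDet ξ a (t • D) = t ^ m * normalDet ξ a D := by
  have h : (innerSL ℝ (ξ : Euc (m + 1))).smulRight a + t • D =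
      ((innerSL ℝ (ξ : Euc (m + 1))).smulRight a + D).comp
        (t • (1 + ((t⁻¹ - 1) • innerSL ℝ (ξ : Euc (m + 1))).smulRight (ξ : Euc (m + 1)))) := by
    ext1 v
    simp only [add_apply, ContinuousLinearMap.smulRight_apply,
      smul_apply, ContinuousLinearMap.comp_apply, map_smul, map_add, hD,
      one_apply_eq_self, innerSL_apply_apply, inner_sphere_self, add_zero,
      smul_eq_mul, one_smul, smul_add, smul_smul]
    rw [add_right_comm, ← add_smul]
    congr 2
    field_simp
    ring
  rw [normalDet, h, det_comp, det_smul, det_one_add_smulRight, normalDet]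
  simp only [smul_apply, innerSL_apply_apply, inner_sphere_self, smul_eq_mul]
  field_simp
  ring

theorem normalDet_smul_smul {d : ℕ} (ξ : USphere d) (a : Euc d) (D : Euc d →L[ℝ] Euc d) (c : ℝ) :
    normalDet ξ (c • a) (c • D) = c ^ d * normalDet ξ a D := by
  rw [normalDet, normalDet, ← det_smul]
  congr 1
  ext1 v
  simp [smul_comm c]

theorem normalDet_apply_comp_tangentProj {d : ℕ} (ξ : USphere d) (B : Euc d →L[ℝ] Euc d) :
    normalDet ξ (B (ξ : Euc d)) (B.comp (tangentProj ξ)) = B.det := by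
  rw [normalDet]
  congr 1
  ext1 v
  simp [tangentProj]

/-- This is the cofactor expansion along `a`, without choosing a tangent frame. The map in question
is the rank-one update of `B` by `a - B ξ`, and `det_add_vecMulVec` is affine in that vector. The
update by `-B ξ` kills `ξ`, hence has determinant zero, which cancels the contributions of `B ξ` and
of `det B`. -/
theorem normalDet_comp_tangentProj {m : ℕ} (ξ : USphere (m + 1)) (a : Euc (m + 1))
    (B : Euc (m + 1) →L[ℝ] Euc (m + 1)) :
    normalDet ξ a (B.comp (tangentProj ξ)) =
      ∑ i, a i * ((stdMatrix B).updateRow i (fun j => (ξ : Euc (m + 1)) j)).det := by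
  have hrank : ∀ b : Euc (m + 1), (B + (innerSL ℝ (ξ : Euc (m + 1))).smulRight b).det =
      B.det + ∑ i, b i * ((stdMatrix B).updateRow i (fun j => (ξ : Euc (m + 1)) j)).det := by
    intro b
    rw [← det_stdMatrix, ← det_stdMatrix B, ← det_add_vecMulVec]
    congr 1
    ext i j
    simp [stdMatrix, Matrix.vecMulVec_apply, EuclideanSpace.inner_single_right, mul_comm]
  have h0 : (B + (innerSL ℝ (ξ : Euc (m + 1))).smulRight (-B (ξ : Euc (m + 1)))).det = 0 := by
    have : B + (innerSL ℝ (ξ : Euc (m + 1))).smulRight (-B (ξ : Euc (m + 1))) =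
        B.comp (1 + (-innerSL ℝ (ξ : Euc (m + 1))).smulRight (ξ : Euc (m + 1))) := by
      ext1 v
      simp
    rw [this, det_comp, det_one_add_smulRight]
    simp
  have h1 : (innerSL ℝ (ξ : Euc (m + 1))).smulRight a + B.comp (tangentProj ξ) =
      B + (innerSL ℝ (ξ : Euc (m + 1))).smulRight (a + -B (ξ : Euc (m + 1))) := by
    ext1 v
    simp [tangentProj]
    abel
  rw [hrank] at h0
  rw [normalDet, h1, hrank]
  simp only [PiLp.add_apply, add_mul, Finset.sum_add_distrib]
  linarith

/-! ### The Jacobian and the winding density in polar coordinates. -/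

theorem hasFDerivAt_normalize {d : ℕ} (ξ : USphere d) :
    HasFDerivAt (fun x : Euc d => ‖x‖⁻¹ • x) (tangentProj ξ) (ξ : Euc d) := by
  have hξ : ‖(ξ : Euc d)‖ = 1 := by simp
  have hξ0 : (ξ : Euc d) ≠ 0 := norm_ne_zero_iff.1 (by rw [hξ]; exact one_ne_zero)
  have hd : DifferentiableAt ℝ (fun y : Euc d => ‖y‖) (ξ : Euc d) :=
    (contDiffAt_norm ℝ hξ0).differentiableAt one_ne_zero
  have hnorm : HasFDerivAt (fun y : Euc d => ‖y‖) (innerSL ℝ (ξ : Euc d)) (ξ : Euc d) := by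
    have h1 := (hd.hasFDerivAt.pow 2).unique (hasStrictFDerivAt_norm_sq (ξ : Euc d)).hasFDerivAt
    have h2 : fderiv ℝ (fun y : Euc d => ‖y‖) (ξ : Euc d) = innerSL ℝ (ξ : Euc d) := by
      ext1 v
      have := congrArg (fun L : Euc d →L[ℝ] ℝ => L v) h1
      simp at this
      simpa using this
    rw [← h2]
    exact hd.hasFDerivAt
  have hinv : HasFDerivAt (fun y : Euc d => ‖y‖⁻¹) (-innerSL ℝ (ξ : Euc d)) (ξ : Euc d) := by
    have h := (hasDerivAt_inv (x := ‖(ξ : Euc d)‖) (by rw [hξ]; exact one_ne_zero)).comp_hasFDerivAt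
      (ξ : Euc d) hnorm
    convert! h using 1
    simp [hξ]
  have h := hinv.smul (hasFDerivAt_id (ξ : Euc d))
  convert! h using 1
  ext1 v
  simp [tangentProj, sub_eq_add_neg]

section

variable {m : ℕ} {μ : ℝ → USphere (m + 1) → Euc (m + 1)} {t : ℝ} {ξ : USphere (m + 1)}

theorem sphere_coe_ne_zero {d : ℕ} (ξ : USphere d) : (ξ : Euc d) ≠ 0 :=
  norm_ne_zero_iff.1 (by simp)

theorem hasFDerivAt_radialExt (ht : 0 < t)
    (hd : DifferentiableAt ℝ (polarMap μ) (t • (ξ : Euc (m + 1)))) :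
    HasFDerivAt (radialExt (μ t))
      (t • (fderiv ℝ (polarMap μ) (t • (ξ : Euc (m + 1)))).comp (tangentProj ξ))
      (ξ : Euc (m + 1)) := by
  have h1 : HasFDerivAt (fun x : Euc (m + 1) => t • (‖x‖⁻¹ • x)) (t • tangentProj ξ)
      (ξ : Euc (m + 1)) := (hasFDerivAt_normalize ξ).const_smul t
  have h2 : HasFDerivAt (polarMap μ) (fderiv ℝ (polarMap μ) (t • (ξ : Euc (m + 1))))
      ((fun x : Euc (m + 1) => t • (‖x‖⁻¹ • x)) (ξ : Euc (m + 1))) := by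
    simpa using hd.hasFDerivAt
  have h3 := h2.comp (ξ : Euc (m + 1)) h1
  rw [ContinuousLinearMap.comp_smul] at h3
  refine h3.congr_of_eventuallyEq ?_
  filter_upwards [isOpen_compl_singleton.mem_nhds (sphere_coe_ne_zero ξ)] with x hx
  exact radialExt_eq μ ht hx

/-- The Jacobian determinant in polar coordinates. -/
theorem jacobianDet_eq (ht : 0 < t)
    (hd : DifferentiableAt ℝ (polarMap μ) (t • (ξ : Euc (m + 1)))) :
    jacobianDet μ t ξ = t ^ m * (fderiv ℝ (polarMap μ) (t • (ξ : Euc (m + 1)))).det := by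
  have hderiv : HasDerivAt (fun s => μ s ξ)
      (fderiv ℝ (polarMap μ) (t • (ξ : Euc (m + 1))) (ξ : Euc (m + 1))) t := by
    have h1 : HasDerivAt (fun s : ℝ => s • (ξ : Euc (m + 1))) (ξ : Euc (m + 1)) t := by
      simpa using (hasDerivAt_id t).smul_const (ξ : Euc (m + 1))
    refine (hd.hasFDerivAt.comp_hasDerivAt t h1).congr_of_eventuallyEq ?_
    filter_upwards [lt_mem_nhds ht] with s hs
    exact (polarMap_smul μ hs ξ).symm
  rw [jacobianDet, hderiv.deriv, sphereDeriv, (hasFDerivAt_radialExt ht hd).fderiv,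
    normalDet_smul_right _ _ _ ht.ne', normalDet_apply_comp_tangentProj]
  simp [tangentProj_self]

/-- The winding density in polar coordinates. -/
theorem windingDensity_unitMap_eq (ht : 0 < t)
    (hd : DifferentiableAt ℝ (polarMap μ) (t • (ξ : Euc (m + 1)))) (h0 : μ t ξ ≠ 0) :
    windingDensity (unitMap (μ t)) ξ = sphereDensity (polarMap μ) t ξ := by
  set a := μ t ξ with ha
  set B := fderiv ℝ (polarMap μ) (t • (ξ : Euc (m + 1))) with hB
  have hpa : polarMap μ (t • (ξ : Euc (m + 1))) = a := polarMap_smul μ ht ξ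
  have hH := hasFDerivAt_radialExt ht hd
  have hHξ : radialExt (μ t) (ξ : Euc (m + 1)) = a := by
    rw [radialExt_eq μ ht (sphere_coe_ne_zero ξ)]
    simpa using hpa
  set D := t • B.comp (tangentProj ξ) with hD
  have hDξ : D (ξ : Euc (m + 1)) = 0 := by simp [hD, tangentProj_self]
  have ha' : ‖a‖ ≠ 0 := norm_ne_zero_iff.2 h0
  have hinv : DifferentiableAt ℝ (fun y : Euc (m + 1) => ‖y‖⁻¹)
      (radialExt (μ t) (ξ : Euc (m + 1))) := by
    rw [hHξ]
    exact ((contDiffAt_norm (n := 1) ℝ h0).inv ha').differentiableAt one_ne_zero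
  -- The derivative `l` of `‖y‖⁻¹` is never computed: it only adds multiples of `a` to the
  -- tangential columns.
  obtain ⟨l, hl⟩ : ∃ l, HasFDerivAt (fun y : Euc (m + 1) => ‖y‖⁻¹) l
      (radialExt (μ t) (ξ : Euc (m + 1))) := ⟨_, hinv.hasFDerivAt⟩
  have h1 := (hl.comp (ξ : Euc (m + 1)) hH).smul hH
  have h2 : HasFDerivAt (radialExt (unitMap (μ t)))
      (‖a‖⁻¹ • (D + ((‖a‖ • l).comp D).smulRight a)) (ξ : Euc (m + 1)) := by
    convert! h1.congr_of_eventuallyEq ?_ using 1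
    · ext1 v
      simp [hHξ, smul_smul, ha']
    · filter_upwards [isOpen_compl_singleton.mem_nhds (sphere_coe_ne_zero ξ)] with x hx
      have hx0 : x ≠ 0 := hx
      simp [radialExt, unitMap, hx0]
  rw [windingDensity, sphereDeriv, h2.fderiv, unitMap, ← ha, normalDet_smul_smul,
    normalDet_add_smulRight ξ a hDξ (by simp [hDξ]), hD,
    normalDet_smul_right _ _ (by simp [tangentProj_self]) ht.ne', normalDet_comp_tangentProj,
    sphereDensity, hpa, inv_pow]
  ring

end

/-! ### Extension across the origin and the conclusion. -/

/-- Compactness of the sphere makes the continuity at `t = 0` uniform in `ξ`. The radius `‖p‖` keeps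
the whole segment from `p` to `μ t ξ` off the origin, so interpolating between them creates no
zeros. -/
theorem exists_norm_sub_lt {d : ℕ} {μ : ℝ → USphere d → Euc d} {p : Euc d}
    (hcont : ContinuousOn (fun q : ℝ × USphere d => μ q.1 q.2) (Ici 0 ×ˢ univ))
    (hp : p ≠ 0) (hstart : ∀ ξ, μ 0 ξ = p) :
    ∃ δ > 0, ∀ t, 0 ≤ t → t < δ → ∀ ξ, ‖μ t ξ - p‖ < ‖p‖ := by
  have h : ∀ᶠ t in 𝓝 (0 : ℝ), ∀ ξ ∈ (univ : Set (USphere d)), 0 ≤ t → ‖μ t ξ - p‖ < ‖p‖ := by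
    refine isCompact_univ.eventually_forall_of_forall_eventually fun ξ _ => ?_
    have h1 := (hcont (0, ξ) ⟨self_mem_Ici, mem_univ _⟩).sub_const p
    have h0 : ‖μ 0 ξ - p‖ < ‖p‖ := by simpa [hstart] using hp
    have h2 := h1.norm.eventually (gt_mem_nhds h0)
    filter_upwards [eventually_nhdsWithin_iff.1 h2] with q hq h0
    exact hq ⟨h0, mem_univ _⟩
  obtain ⟨δ, hδ, h⟩ := Metric.eventually_nhds_iff.1 h
  exact ⟨δ, hδ, fun t h0 ht ξ => h (by simpa [abs_of_nonneg h0] using ht) ξ (mem_univ _) h0⟩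

/-- A map in polar coordinates can be modified near the origin to a `C¹` map with the same
zeros. -/
theorem exists_contDiff_extension {m : ℕ} {μ : ℝ → USphere (m + 1) → Euc (m + 1)}
    {p : Euc (m + 1)}
    (hcont : ContinuousOn (fun q : ℝ × USphere (m + 1) => μ q.1 q.2) (Ici 0 ×ˢ univ))
    (hdiff : ContMDiffOn (𝓘(ℝ, ℝ).prod (𝓡 m)) 𝓘(ℝ, Euc (m + 1)) 1
      (fun q : ℝ × USphere (m + 1) => μ q.1 q.2) (Ioi 0 ×ˢ univ))
    (hp : p ≠ 0) (hstart : ∀ ξ, μ 0 ξ = p) :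
    ∃ F : Euc (m + 1) → Euc (m + 1), ContDiff ℝ 1 F ∧ ∃ δ > 0,
      (∀ x, δ ≤ ‖x‖ → F =ᶠ[𝓝 x] polarMap μ) ∧ (∀ x, ‖x‖ < δ → F x ≠ 0) ∧
      ∀ q ∈ zeroSet μ, δ ≤ q.1 := by
  obtain ⟨δ, hδ, hμ⟩ := exists_norm_sub_lt hcont hp hstart
  -- The bump interpolates between the constant `p` near the origin, where `polarMap μ` need not be
  -- differentiable, and `polarMap μ` beyond `δ / 2`. The margin up to `δ` gives agreement on
  -- neighbourhoods, hence of derivatives.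
  set b : ContDiffBump (0 : Euc (m + 1)) := ⟨δ / 4, δ / 2, by linarith, by linarith⟩ with hb
  refine ⟨fun x => p + (1 - b x) • (polarMap μ x - p), ?_, δ, hδ, ?_, ?_, ?_⟩
  · rw [contDiff_iff_contDiffAt]
    intro x
    by_cases hx : x = 0
    · have hmem : ball (0 : Euc (m + 1)) (δ / 4) ∈ 𝓝 x :=
        isOpen_ball.mem_nhds (by rw [hx]; exact mem_ball_self (by linarith))
      refine (contDiffAt_const (c := p)).congr_of_eventuallyEq ?_
      filter_upwards [hmem] with y hy
      rw [b.one_of_mem_closedBall (ball_subset_closedBall hy), sub_self, zero_smul, add_zero]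
    · have h2 : ContDiffAt ℝ 1 (fun y : Euc (m + 1) => 1 - b y) x :=
        contDiffAt_const.sub b.contDiffAt
      exact contDiffAt_const.add (h2.smul ((contDiffAt_polarMap hdiff hx).sub contDiffAt_const))
  · intro x hx
    filter_upwards [continuous_norm.continuousAt.eventually
      (lt_mem_nhds (show δ / 2 < ‖x‖ by linarith))] with y hy
    rw [b.zero_of_le_dist (by simpa using hy.le), sub_zero, one_smul, add_sub_cancel]
  · intro x hx h0
    have h1 : (1 - b x) • (polarMap μ x - p) = -p := (neg_eq_of_add_eq_zero_right h0).symm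
    by_cases hx0 : x = 0
    · rw [hx0, b.one_of_mem_closedBall (mem_closedBall_self (by simp [hb]; linarith)), sub_self,
        zero_smul] at h1
      exact hp (neg_eq_zero.1 h1.symm)
    · obtain ⟨ξ, hξ⟩ := exists_eq_smul hx0
      have hG : polarMap μ x = μ ‖x‖ ξ := by
        conv_lhs => rw [hξ]
        exact polarMap_smul μ (norm_pos_iff.2 hx0) ξ
      have h2 := congrArg norm h1
      rw [norm_neg, norm_smul, hG, Real.norm_of_nonneg (sub_nonneg.2 b.le_one)] at h2
      have h3 := hμ ‖x‖ (norm_nonneg x) hx ξ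
      have h4 : (1 - b x) * ‖μ ‖x‖ ξ - p‖ ≤ 1 * ‖μ ‖x‖ ξ - p‖ :=
        mul_le_mul_of_nonneg_right (by linarith [b.nonneg (x := x)]) (norm_nonneg _)
      linarith
  · intro q hq
    by_contra h
    have := hμ q.1 hq.1 (not_le.1 h) q.2
    rw [hq.2, zero_sub, norm_neg] at this
    exact lt_irrefl _ this

theorem surfaceMeasure_real_univ_ne_zero (m : ℕ) : (surfaceMeasure (m + 1)).real univ ≠ 0 := by
  have : surfaceMeasure (m + 1) ≠ 0 := Measure.toSphere_ne_zero _
  have : NeZero (surfaceMeasure (m + 1)) := ⟨this⟩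
  exact measureReal_univ_ne_zero

theorem Real.sign_pos_mul {c x : ℝ} (hc : 0 < c) : Real.sign (c * x) = Real.sign x := by
  rcases lt_trichotomy x 0 with h | rfl | h
  · rw [Real.sign_of_neg h, Real.sign_of_neg (mul_neg_of_pos_of_neg hc h)]
  · rw [mul_zero]
  · rw [Real.sign_of_pos h, Real.sign_of_pos (mul_pos hc h)]

theorem mainTheorem7 (m : ℕ) (μ : ℝ → USphere (m + 1) → Euc (m + 1)) (p : Euc (m + 1))
    (hcont : ContinuousOn (fun q : ℝ × USphere (m + 1) => μ q.1 q.2) (Ici 0 ×ˢ univ))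
    (hdiff : ContMDiffOn (𝓘(ℝ, ℝ).prod (𝓡 m)) 𝓘(ℝ, Euc (m + 1)) 1
      (fun q : ℝ × USphere (m + 1) => μ q.1 q.2) (Ioi 0 ×ˢ univ))
    (hp : p ≠ 0) (hstart : ∀ ξ, μ 0 ξ = p)
    (hfin : (zeroSet μ).Finite)
    (hnondeg : ∀ q ∈ zeroSet μ, jacobianDet μ q.1 q.2 ≠ 0) :
    (∀ᶠ t in atTop, (∀ ξ, μ t ξ ≠ 0) ∧
      Integrable (windingDensity (unitMap (μ t))) (surfaceMeasure (m + 1))) ∧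
    Tendsto (fun t => windingNumber (μ t)) atTop
      (𝓝 (∑ q ∈ hfin.toFinset, Real.sign (jacobianDet μ q.1 q.2))) := by
  classical
  obtain ⟨F, hF, δ, hδ, hFG, hF0, hZδ⟩ := exists_contDiff_extension hcont hdiff hp hstart
  have hnorm : ∀ (t : ℝ) (ξ : USphere (m + 1)), 0 < t → ‖t • (ξ : Euc (m + 1))‖ = t := by
    intro t ξ ht
    have hξ : ‖(ξ : Euc (m + 1))‖ = 1 := by simp
    rw [norm_smul, hξ, mul_one, Real.norm_of_nonneg ht.le]
  have hpolar : ∀ (t : ℝ) (ξ : USphere (m + 1)), δ ≤ t → F (t • (ξ : Euc (m + 1))) = μ t ξ := by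
    intro t ξ ht
    have ht0 : 0 < t := hδ.trans_le ht
    rw [(hFG _ (by rwa [hnorm t ξ ht0])).eq_of_nhds, polarMap_smul μ ht0]
  have hfd : ∀ (t : ℝ) (ξ : USphere (m + 1)), δ ≤ t →
      fderiv ℝ F (t • (ξ : Euc (m + 1))) = fderiv ℝ (polarMap μ) (t • (ξ : Euc (m + 1))) := by
    intro t ξ ht
    exact (hFG _ (by rwa [hnorm t ξ (hδ.trans_le ht)])).fderiv_eq
  have hd : ∀ (t : ℝ) (ξ : USphere (m + 1)), 0 < t →
      DifferentiableAt ℝ (polarMap μ) (t • (ξ : Euc (m + 1))) := fun t ξ ht =>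
    (contDiffAt_polarMap hdiff (smul_ne_zero ht.ne' (sphere_coe_ne_zero ξ))).differentiableAt
      one_ne_zero
  have hjac : ∀ (t : ℝ) (ξ : USphere (m + 1)), δ ≤ t →
      jacobianDet μ t ξ = t ^ m * (fderiv ℝ F (t • (ξ : Euc (m + 1)))).det := by
    intro t ξ ht
    have ht0 : 0 < t := hδ.trans_le ht
    rw [hfd t ξ ht, jacobianDet_eq ht0 (hd t ξ ht0)]
  set Z : Finset (Euc (m + 1)) := hfin.toFinset.image fun q => q.1 • (q.2 : Euc (m + 1)) with hZdef
  have hZ : ∀ x, F x = 0 ↔ x ∈ Z := by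
    intro x
    rw [hZdef, Finset.mem_image]
    constructor
    · intro h
      have hx : δ ≤ ‖x‖ := not_lt.1 fun hlt => hF0 x hlt h
      obtain ⟨ξ, hξ⟩ := exists_eq_smul (norm_pos_iff.1 (hδ.trans_le hx))
      refine ⟨(‖x‖, ξ), hfin.mem_toFinset.2 ⟨norm_nonneg x, ?_⟩, hξ.symm⟩
      rw [← hpolar _ ξ hx, ← hξ, h]
    · rintro ⟨q, hq, rfl⟩
      have hq' := hfin.mem_toFinset.1 hq
      rw [hpolar _ _ (hZδ q hq'), hq'.2]
  have hdet : ∀ z ∈ Z, (fderiv ℝ F z).det ≠ 0 := by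
    intro z hz h0
    obtain ⟨q, hq, rfl⟩ := Finset.mem_image.1 hz
    have hq' := hfin.mem_toFinset.1 hq
    apply hnondeg q hq'
    rw [hjac _ _ (hZδ q hq'), h0, mul_zero]
  have hsum : ∑ q ∈ hfin.toFinset, Real.sign (jacobianDet μ q.1 q.2) =
      ∑ z ∈ Z, Real.sign (fderiv ℝ F z).det := by
    rw [hZdef, Finset.sum_image]
    · refine Finset.sum_congr rfl fun q hq => ?_
      have hq' := hZδ q (hfin.mem_toFinset.1 hq)
      rw [hjac _ _ hq', Real.sign_pos_mul (pow_pos (hδ.trans_le hq') m)]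
    -- Distinct zeros stay distinct in `ℝ^d` because all have `t ≥ δ > 0`, where polar coordinates
    -- are injective.
    · intro q hq q' hq' h
      have h1 := hδ.trans_le (hZδ q (hfin.mem_toFinset.1 hq))
      have h2 := hδ.trans_le (hZδ q' (hfin.mem_toFinset.1 hq'))
      simp only at h
      have h3 : q.1 = q'.1 := by rw [← hnorm q.1 q.2 h1, h, hnorm q'.1 q'.2 h2]
      rw [h3] at h
      exact Prod.ext h3 (Subtype.ext (smul_right_injective _ h2.ne' h))
  obtain ⟨T, hT⟩ : ∃ T, δ ≤ T ∧ ∀ z ∈ Z, ‖z‖ < T := by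
    obtain ⟨R, hR, h⟩ := Z.finite_toSet.isBounded.subset_ball_lt δ (0 : Euc (m + 1))
    exact ⟨R, hR.le, fun z hz => by simpa using h hz⟩
  have hT0 : 0 < T := hδ.trans_le hT.1
  have hne : ∀ t, T < t → ∀ ξ, μ t ξ ≠ 0 := by
    intro t ht ξ h0
    rw [← hpolar t ξ (hT.1.trans ht.le), hZ] at h0
    have := hT.2 _ h0
    rw [hnorm t ξ (hT0.trans ht)] at this
    exact lt_asymm ht this
  have hdens : ∀ t, T < t → windingDensity (unitMap (μ t)) = sphereDensity F t := by
    intro t ht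
    funext ξ
    have ht0 := hT0.trans ht
    have htδ := hT.1.trans ht.le
    rw [windingDensity_unitMap_eq ht0 (hd t ξ ht0) (hne t ht ξ), sphereDensity, sphereDensity,
      hfd t ξ htδ, hpolar t ξ htδ, polarMap_smul μ ht0]
  refine ⟨?_, ?_⟩
  · filter_upwards [eventually_gt_atTop T] with t ht
    refine ⟨hne t ht, ?_⟩
    rw [hdens t ht]
    have hc : Continuous (sphereDensity F t) :=
      (continuous_sphereDensity hF hT0 fun x hx h0 => lt_asymm hx (hT.2 x ((hZ x).1 h0))).comp
        (f := fun ξ => ((⟨t, ht⟩ : Ioi T), ξ)) (by fun_prop)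
    exact hc.integrable_of_hasCompactSupport (HasCompactSupport.of_compactSpace _)
  · rw [hsum]
    -- The winding number is not merely convergent: it equals the signed count for every `t > T`.
    refine tendsto_const_nhds.congr' ?_
    filter_upwards [eventually_gt_atTop T] with t ht
    rw [windingNumber, hdens t ht, integral_sphereDensity_eq hF hZ hdet hT0 hT.2 ht]
    field_simp [surfaceMeasure_real_univ_ne_zero m]

end
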